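/- All manifolds are smooth, Hausdorff, second countable and without boundary. For a smooth symmetric $(0,2)$-tensor $\gamma$ on $\mathcal N$ put $\mathrm{Rad}_\gamma|_p=\{V\in T_p\mathcal N:\gamma(V,\cdot)=0\}$. $(\mathcal N,\gamma)$ is a *null manifold* if $\dim\mathrm{Rad}_\gamma|_p=1$ for all $p$, and it is *ruled* if moreover the line bundle $\bigcup_p\mathrm{Rad}_\gamma|_p$ is trivial, i.e. has a smooth nowhere-zero section. *Null metric hypersurface data* $\{U,\gamma,\ell,\ell^{(2)}\}$ consist of a null manifold $(U,\gamma)$, a smooth covector field $\ell$ and a smooth function $\ell^{(2)}$ on $U$ such that $$\mathcal A((X_1,a_1),(X_2,a_2))=\gamma(X_1,X_2)+a_1\ell(X_2)+a_2\ell(X_1)+a_1a_2\ell^{(2)}$$ is non-degenerate on $T_pU\oplus\mathbb R$ for every $p\in U$. Let $n$ be the vector field with $\gamma(n,\cdot)=0$, $\ell(n)=1$, and let $\mathbf U=\tfrac12\pounds_n\gamma$. The *metric hypersurface connection* of the data is the smooth torsion-free connection $\nabla$ on $U$ with $$(\nabla_X\gamma)(Z,W)=-\mathbf U(X,Z)\ell(W)-\mathbf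 U(X,W)\ell(Z),\qquad(\nabla_X\ell)(Z)+(\nabla_Z\ell)(X)=-2\ell^{(2)}\,\mathbf U(X,Z).$$ For a nowhere-zero function $z$ and a vector field $\zeta$, the gauge element $(z,\zeta)$ sends $\ell$ to $z(\ell+\gamma(\zeta,\cdot))$ and $\ell^{(2)}$ to $z^2(\ell^{(2)}+2\ell(\zeta)+\gamma(\zeta,\zeta))$, and fixes $\gamma$. A *radical double cover* of $(\mathcal N,\gamma)$ is a smooth two-sheeted covering $f:\widetilde{\mathcal N}\to\mathcal N$ that is a local diffeomorphism and for which $(\widetilde{\mathcal N},f^\star\gamma)$ is ruled; $\widetilde{\mathcal N}$ need not be connected. Data $\{\widetilde{\mathcal N},f^\star\gamma,\tilde\ell,\tilde\ell^{(2)}\}$ are *compatible* with $f$ if at any two points of a common fibre the push-forwards of $\tilde\ell$ by $f$ agree up to a sign, and $\tilde\ell^{(2)}=f^\star h$ for a smooth function $h$ on $\mathcal N$. A connection $\widetilde\nabla$ on $\widetilde{\mathcal N}$ *descends* to a connection $\nabla$ on $\mathcal N$ if $f$ carries $\widetilde\nabla$ to $\nabla$, that is, $df(\widetilde\nabla_v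 f^\star Z)=\nabla_{df(v)}Z$ for all tangent vectors $v$ of $\widetilde{\mathcal N}$ and smooth vector fields $Z$ on $\mathcal N$. **Theorem 3.3.** Let $(\mathcal N,\gamma)$ be a null manifold. It has a radical double cover. For every radical double cover $f:\widetilde{\mathcal N}\to\mathcal N$: 1. Data compatible with $f$ exist. For all compatible data the metric hypersurface connection on $\widetilde{\mathcal N}$ exists and descends to a unique connection on $\mathcal N$. Let $\mathcal Q$ be the (hence non-empty) family of all connections on $\mathcal N$ obtained in this way. 2. Every $\nabla\in\mathcal Q$ is a smooth, torsion-free, globally defined connection on $\mathcal N$, and for every non-empty open $U\subset\mathcal N$ for which $(U,\gamma|_U)$ is ruled, $\nabla|_U$ is the metric hypersurface connection of some null metric hypersurface data $\{U,\gamma|_U,\ell,\ell^{(2)}\}$. 3. If $(\mathcal N,\gamma)$ is itself ruled, $\mathcal Q$ is the set of the metric hypersurface connections of all null metric hypersurface data $\{\mathcal N,\gamma,\ell,\ell^{(2)}\}$. Moreover, for all null metric hypersurface data $\{U,\gamma|_U,\ell,\ell^{(2)}\}$ on an open $U\subset\mathcal N$, the gauge element $(z,\zeta)=(-1,0)$ produces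 null metric hypersurface data with the same metric hypersurface connection. -/

import Mathlib

open scoped Manifold ContDiff Bundle

universe u

noncomputable section

namespace NullGeometry

/-- Vector fields on an `n`-dimensional manifold `N`. Smoothness is imposed separately. -/
abbrev VField (n : ℕ) (N : Type u) [TopologicalSpace N]
    [ChartedSpace (EuclideanSpace ℝ (Fin n)) N] : Type u :=
  (x : N) → TangentSpace (𝓡 n) x

/-- Covector fields. Smoothness is imposed separately. -/
abbrev CovectorField (n : ℕ) (N : Type u) [TopologicalSpace N]
    [ChartedSpace (EuclideanSpace ℝ (Fin n)) N] : Type u :=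
  (x : N) → TangentSpace (𝓡 n) x →L[ℝ] ℝ

/-- `(0,2)`-tensor fields. Smoothness is imposed separately. -/
abbrev TensorField (n : ℕ) (N : Type u) [TopologicalSpace N]
    [ChartedSpace (EuclideanSpace ℝ (Fin n)) N] : Type u :=
  (x : N) → TangentSpace (𝓡 n) x →L[ℝ] TangentSpace (𝓡 n) x →L[ℝ] ℝ

/-- Raw operators `∇`, in Mathlib's argument order: `(∇_X Z)(x) = cov Z x (X x)`. -/
abbrev RawConnection (n : ℕ) (N : Type u) [TopologicalSpace N]
    [ChartedSpace (EuclideanSpace ℝ (Fin n)) N] : Type u :=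
  VField n N → (x : N) → TangentSpace (𝓡 n) x →L[ℝ] TangentSpace (𝓡 n) x

/-- Affine connections on `N`: Mathlib's covariant derivatives on the tangent bundle. -/
abbrev Connection (n : ℕ) (N : Type u) [TopologicalSpace N]
    [ChartedSpace (EuclideanSpace ℝ (Fin n)) N] [IsManifold (𝓡 n) ∞ N] : Type u :=
  CovariantDerivative (𝓡 n) (EuclideanSpace ℝ (Fin n))
    (TangentSpace (𝓡 n) : N → Type _)

section OneManifold

variable {n : ℕ} {N : Type u} [TopologicalSpace N]
  [ChartedSpace (EuclideanSpace ℝ (Fin n)) N] [IsManifold (𝓡 n) ∞ N]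

/-- The vector field `X` is smooth on the set `U`. -/
def SmoothFieldOn (X : VField n N) (U : Set N) : Prop :=
  ContMDiffOn (𝓡 n) ((𝓡 n).prod 𝓘(ℝ, EuclideanSpace ℝ (Fin n))) ∞
    (fun x ↦ Bundle.TotalSpace.mk' (EuclideanSpace ℝ (Fin n)) x (X x)) U

/-- The vector field `X` is smooth at the point `x`. -/
def SmoothFieldAt (X : VField n N) (x : N) : Prop :=
  ContMDiffAt (𝓡 n) ((𝓡 n).prod 𝓘(ℝ, EuclideanSpace ℝ (Fin n))) ∞
    (fun y ↦ Bundle.TotalSpace.mk' (EuclideanSpace ℝ (Fin n)) y (X y)) x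

/-- The covector field `ℓ` is smooth on the set `U`. -/
def SmoothCovectorOn (ℓ : CovectorField n N) (U : Set N) : Prop :=
  ContMDiffOn (𝓡 n) ((𝓡 n).prod 𝓘(ℝ, EuclideanSpace ℝ (Fin n) →L[ℝ] ℝ)) ∞
    (fun x ↦ Bundle.TotalSpace.mk' (EuclideanSpace ℝ (Fin n) →L[ℝ] ℝ)
      (E := fun x : N ↦ TangentSpace (𝓡 n) x →L[ℝ] ℝ) x (ℓ x)) U

/-- The `(0,2)`-tensor field `γ` is smooth on the set `U`. -/
def SmoothTensorOn (γ : TensorField n N) (U : Set N) : Prop :=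
  ContMDiffOn (𝓡 n) ((𝓡 n).prod
      𝓘(ℝ, EuclideanSpace ℝ (Fin n) →L[ℝ] EuclideanSpace ℝ (Fin n) →L[ℝ] ℝ)) ∞
    (fun x ↦ Bundle.TotalSpace.mk'
      (EuclideanSpace ℝ (Fin n) →L[ℝ] EuclideanSpace ℝ (Fin n) →L[ℝ] ℝ)
      (E := fun x : N ↦ TangentSpace (𝓡 n) x →L[ℝ] TangentSpace (𝓡 n) x →L[ℝ] ℝ) x (γ x)) U

/-- The radical of `γ` at `x`: the vectors `V` with `γ(V, ·) = 0`. -/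
def radical (γ : TensorField n N) (x : N) : Submodule ℝ (TangentSpace (𝓡 n) x) :=
  LinearMap.ker (γ x).toLinearMap

/-- `(U, γ|_U)` is a null manifold: on `U`, `γ` is smooth and symmetric with one-dimensional
radical at every point. Only the values of `γ` on `U` matter. -/
structure IsNullOn (γ : TensorField n N) (U : Set N) : Prop where
  smooth : SmoothTensorOn γ U
  symm : ∀ x ∈ U, ∀ v w : TangentSpace (𝓡 n) x, γ x v w = γ x w v
  finrank_radical : ∀ x ∈ U, Module.finrank ℝ (radical γ x) = 1

/-- `(U, γ|_U)` is a ruled null manifold: a null manifold whose radical line bundle is trivial,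
i.e. has a smooth nowhere-zero section. -/
structure IsRuledOn (γ : TensorField n N) (U : Set N) : Prop where
  null : IsNullOn γ U
  exists_section : ∃ X : VField n N, SmoothFieldOn X U ∧ ∀ x ∈ U, X x ∈ radical γ x ∧ X x ≠ 0

/-- The symmetric form `𝒜|_x` on `T_x N ⊕ ℝ` attached to `(γ, ℓ, ℓ⁽²⁾)`. -/
def ambientForm (γ : TensorField n N) (ℓ : CovectorField n N) (ℓ₂ : N → ℝ) (x : N)
    (p q : TangentSpace (𝓡 n) x × ℝ) : ℝ :=
  γ x p.1 q.1 + p.2 * ℓ x q.1 + q.2 * ℓ x p.1 + p.2 * q.2 * ℓ₂ x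

/-- `{U, γ|_U, ℓ, ℓ⁽²⁾}` is null metric hypersurface data. -/
structure IsNullDataOn (γ : TensorField n N) (ℓ : CovectorField n N) (ℓ₂ : N → ℝ)
    (U : Set N) : Prop where
  null : IsNullOn γ U
  smooth_covector : SmoothCovectorOn ℓ U
  smooth_scalar : ContMDiffOn (𝓡 n) 𝓘(ℝ, ℝ) ∞ ℓ₂ U
  nondegenerate : ∀ x ∈ U, ∀ p : TangentSpace (𝓡 n) x × ℝ,
    (∀ q, ambientForm γ ℓ ℓ₂ x p q = 0) → p = 0

/-- The vector field `n` of the data: at each point of the domain of the data it is the unique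
vector with `γ(n, ·) = 0` and `ℓ(n) = 1`. -/
def nullVector (γ : TensorField n N) (ℓ : CovectorField n N) : VField n N :=
  fun x ↦ Classical.epsilon fun v : TangentSpace (𝓡 n) x ↦ γ x v = 0 ∧ ℓ x v = 1

/-- The Lie derivative `(£_V γ)(X, Z) = V(γ(X, Z)) - γ([V, X], Z) - γ(X, [V, Z])` at `x`. -/
def lieDerivative (V : VField n N) (γ : TensorField n N) (X Z : VField n N) (x : N) : ℝ :=
  mvfderiv (𝓡 n) (fun y ↦ γ y (X y) (Z y)) x (V x)
    - γ x (VectorField.mlieBracket (𝓡 n) V X x) (Z x)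
    - γ x (X x) (VectorField.mlieBracket (𝓡 n) V Z x)

/-- The tensor `U = ½ £_n γ` of the data, evaluated on the fields `X, Z` at `x`. -/
def tensorU (γ : TensorField n N) (ℓ : CovectorField n N) (X Z : VField n N) (x : N) : ℝ :=
  (1 / 2) * lieDerivative (nullVector γ ℓ) γ X Z x

/-- `(∇_X γ)(Z, W)` at `x`. -/
def covTensor (cov : RawConnection n N) (γ : TensorField n N) (X Z W : VField n N)
    (x : N) : ℝ :=
  mvfderiv (𝓡 n) (fun y ↦ γ y (Z y) (W y)) x (X x)
    - γ x (cov Z x (X x)) (W x) - γ x (Z x) (cov W x (X x))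

/-- `(∇_X ℓ)(Z)` at `x`. -/
def covCovector (cov : RawConnection n N) (ℓ : CovectorField n N) (X Z : VField n N)
    (x : N) : ℝ :=
  mvfderiv (𝓡 n) (fun y ↦ ℓ y (Z y)) x (X x) - ℓ x (cov Z x (X x))

/-- On the open set `U`, `cov` is the metric hypersurface connection of `{U, γ|_U, ℓ, ℓ⁽²⁾}`:
a smooth torsion-free connection on `U` with
`(∇_X γ)(Z, W) = - U(X, Z) ℓ(W) - U(X, W) ℓ(Z)` and
`(∇_X ℓ)(Z) + (∇_Z ℓ)(X) = - 2 ℓ⁽²⁾ U(X, Z)`.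
All conditions are local, so they are tested at each point of `U` on vector fields that are smooth
at that point. -/
structure IsMetricHypersurfaceConnectionOn (γ : TensorField n N) (ℓ : CovectorField n N)
    (ℓ₂ : N → ℝ) (cov : RawConnection n N) (U : Set N) : Prop where
  isCov : IsCovariantDerivativeOn (I := 𝓡 n) (EuclideanSpace ℝ (Fin n)) cov U
  smooth : ContMDiffCovariantDerivativeOn (I := 𝓡 n) (EuclideanSpace ℝ (Fin n)) ∞ cov U
  torsionFree : ∀ x ∈ U, ∀ X Z : VField n N, SmoothFieldAt X x → SmoothFieldAt Z x →
    cov Z x (X x) - cov X x (Z x) = VectorField.mlieBracket (𝓡 n) X Z x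
  cov_gamma : ∀ x ∈ U, ∀ X Z W : VField n N,
    SmoothFieldAt X x → SmoothFieldAt Z x → SmoothFieldAt W x →
    covTensor cov γ X Z W x = - tensorU γ ℓ X Z x * ℓ x (W x) - tensorU γ ℓ X W x * ℓ x (Z x)
  cov_ell : ∀ x ∈ U, ∀ X Z : VField n N, SmoothFieldAt X x → SmoothFieldAt Z x →
    covCovector cov ℓ X Z x + covCovector cov ℓ Z X x = - 2 * ℓ₂ x * tensorU γ ℓ X Z x

/-- The metric hypersurface connections of all null metric hypersurface data on `(N, γ)`. -/
def metricHypersurfaceFamily (γ : TensorField n N) : Set (Connection n N) :=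
  {cov | ∃ (ℓ : CovectorField n N) (ℓ₂ : N → ℝ), IsNullDataOn γ ℓ ℓ₂ Set.univ ∧
    IsMetricHypersurfaceConnectionOn γ ℓ ℓ₂ cov Set.univ}

/-- Gauge action on the covector: `z (ℓ + γ(ζ, ·))`. -/
def gaugeCovector (z : N → ℝ) (ζ : VField n N) (γ : TensorField n N) (ℓ : CovectorField n N) :
    CovectorField n N :=
  fun x ↦ z x • (ℓ x + γ x (ζ x))

/-- Gauge action on the scalar: `z² (ℓ⁽²⁾ + 2 ℓ(ζ) + γ(ζ, ζ))`. -/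
def gaugeScalar (z : N → ℝ) (ζ : VField n N) (γ : TensorField n N) (ℓ : CovectorField n N)
    (ℓ₂ : N → ℝ) : N → ℝ :=
  fun x ↦ z x ^ 2 * (ℓ₂ x + 2 * ℓ x (ζ x) + γ x (ζ x) (ζ x))

end OneManifold

section Covering

variable {n : ℕ} {N : Type u} [TopologicalSpace N]
  [ChartedSpace (EuclideanSpace ℝ (Fin n)) N] [IsManifold (𝓡 n) ∞ N]
  {C : Type u} [TopologicalSpace C]
  [ChartedSpace (EuclideanSpace ℝ (Fin n)) C] [IsManifold (𝓡 n) ∞ C]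

/-- The pull-back `f^⋆ γ` of a `(0,2)`-tensor field. -/
def pullbackTensor (f : C → N) (γ : TensorField n N) : TensorField n C :=
  fun q ↦ (ContinuousLinearMap.precomp ℝ (mfderiv (𝓡 n) (𝓡 n) f q)).comp
    ((γ (f q)).comp (mfderiv (𝓡 n) (𝓡 n) f q))

/-- `f : C → N` is a smooth double covering that trivializes the radical line bundle of `γ`,
i.e. `(C, f^⋆ γ)` is ruled. -/
structure IsRadicalDoubleCover (γ : TensorField n N) (f : C → N) : Prop where
  isCoveringMap : IsCoveringMap f
  two_sheets : ∀ p : N, (f ⁻¹' {p}).ncard = 2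
  isLocalDiffeomorph : IsLocalDiffeomorph (𝓡 n) (𝓡 n) ∞ f
  ruled : IsRuledOn (pullbackTensor f γ) Set.univ

/-- Null metric hypersurface data `{C, f^⋆ γ, ℓ, ℓ⁽²⁾}` compatible with the covering `f`.
`VectorField.mpullback _ _ f V q` is `(df_q)⁻¹ (V (f q))`, so `sign` says that at two points of
the same fibre the push-forwards of `ℓ` under `f` agree up to a sign. -/
structure IsCompatibleData (γ : TensorField n N) (f : C → N) (ℓ : CovectorField n C)
    (ℓ₂ : C → ℝ) : Prop where
  data : IsNullDataOn (pullbackTensor f γ) ℓ ℓ₂ Set.univ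
  sign : ∀ q₁ q₂ : C, f q₁ = f q₂ → ∃ ε : ℝ, (ε = 1 ∨ ε = -1) ∧ ∀ V : VField n N,
    ℓ q₂ (VectorField.mpullback (𝓡 n) (𝓡 n) f V q₂)
      = ε * ℓ q₁ (VectorField.mpullback (𝓡 n) (𝓡 n) f V q₁)
  descends : ∃ h : N → ℝ, ContMDiff (𝓡 n) 𝓘(ℝ, ℝ) ∞ h ∧ ∀ q, ℓ₂ q = h (f q)

/-- The connection `covC` on the covering descends to the connection `cov` on `N`: the local
diffeomorphism `f` carries `covC` to `cov`. -/
def DescendsTo (f : C → N) (covC : Connection n C) (cov : Connection n N) : Prop :=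
  ∀ (q : C) (Z : VField n N), SmoothFieldAt Z (f q) → ∀ v : TangentSpace (𝓡 n) q,
    mfderiv (𝓡 n) (𝓡 n) f q (covC (VectorField.mpullback (𝓡 n) (𝓡 n) f Z) q v)
      = cov Z (f q) (mfderiv (𝓡 n) (𝓡 n) f q v)

/-- The family `𝒬` of connections on `N` to which the metric hypersurface connections of the data
compatible with the double covering `f` descend. -/
def descendedFamily (γ : TensorField n N) (f : C → N) : Set (Connection n N) :=
  {cov | ∃ (ℓ : CovectorField n C) (ℓ₂ : C → ℝ) (covC : Connection n C),
    IsCompatibleData γ f ℓ ℓ₂ ∧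
    IsMetricHypersurfaceConnectionOn (pullbackTensor f γ) ℓ ℓ₂ covC Set.univ ∧
    DescendsTo f covC cov}

end Covering

end NullGeometry

end

/-!
The two conditions on a metric hypersurface connection, together with vanishing torsion, are
equivalent to explicit formulas for `γ(∇_X Z, W)` and `ℓ(∇_X Z)`, obtained by the cyclic permutation
of Koszul's formula (`SatisfiesKoszulAt`, `isMetricHypersurfaceConnectionOn_iff`). Non-degeneracy of
the form `𝒜` on `T_x N ⊕ ℝ` amounts, for a one-dimensional radical, to `ℓ` being non-zero on the
radical (`TransverseAt`); then `γ` and `ℓ` together separate tangent vectors, which is uniqueness of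
`∇` (`SatisfiesKoszulAt.eq_of_transverseAt`). For existence the formulas are combined into a formula
for `(γ + ℓ ⊗ ℓ)(∇_X Z, W)`, which is tensorial in `X` and `W`, and the index is raised with the
inverse of the non-degenerate form `γ + ℓ ⊗ ℓ` (`koszulConnection`,
`exists_metricHypersurfaceConnection`). The combined formula gives back both of the original ones
because Koszul's expression with `W = n` is `-U(X, Z)` (`RegularDataAt.koszul_nullVector`).

The formulas do not change under `ℓ ↦ -ℓ`: then `n`, hence `U`, changes sign as well
(`SatisfiesKoszulAt.neg`). This is the statement on the gauge element `(-1, 0)`. The formulas are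
also natural under local diffeomorphisms (`SatisfiesKoszulAt.of_pullback`). So for compatible data
on a radical double cover the push-forwards of the connection from the two sheets solve, near each
point, the same Koszul equations, and agree (`IsCompatibleData.pushConnection_eq`); this is descent.
On an open set where the radical has a smooth nowhere-zero section `X`, the sign of the
push-forward of `ℓ` can be fixed by requiring it to be positive on `X`. The result is smooth data
whose metric hypersurface connection is the descended one (`orientedPushCovector`,
`exists_data_of_mem_descendedFamily`). As null manifolds are locally ruled, this also gives
smoothness and vanishing torsion. Conversely, data on a ruled `N` pull back to compatible data on
the cover (`descendedFamily_eq_of_isRuledOn`).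

Compatible data and a radical double cover are both built from a bilinear form `β` on `N`
that is positive on the radical, which a partition of unity provides
(`IsNullOn.exists_pos_on_radical`). If `X` spans the radical on the cover, the covector
`β(X, ·) / √β(X, X)` changes only by a sign when `X` is rescaled
(`IsRadicalDoubleCover.exists_isCompatibleData`). The double cover is the bundle of the
orientations of the radical, that is, of the vectors `V` in it with `β(V, V) = 1`, glued from
local sections by transition functions with values in `ℤˣ` (`orientationCore`) and given the smooth
structure lifted from `N` (`liftedChartedSpace`).
-/

noncomputable section

namespace NullGeometry

open Filter Topology VectorField Bundle

/-! ### Smoothness of sections of hom bundles -/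

section HomSections

variable {B : Type*} {E₁ : B → Type*} {E₂ : B → Type*} {F₁ F₂ : Type*}
  [∀ x, AddCommGroup (E₁ x)] [∀ x, Module ℝ (E₁ x)] [NormedAddCommGroup F₁] [NormedSpace ℝ F₁]
  [TopologicalSpace (TotalSpace F₁ E₁)] [∀ x, TopologicalSpace (E₁ x)]
  [∀ x, AddCommGroup (E₂ x)] [∀ x, Module ℝ (E₂ x)] [NormedAddCommGroup F₂] [NormedSpace ℝ F₂]
  [TopologicalSpace (TotalSpace F₂ E₂)] [∀ x, TopologicalSpace (E₂ x)]
  {EB : Type*} [NormedAddCommGroup EB] [NormedSpace ℝ EB] {HB : Type*} [TopologicalSpace HB]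
  {IB : ModelWithCorners ℝ EB HB} [TopologicalSpace B] [ChartedSpace HB B]
  [FiberBundle F₁ E₁] [VectorBundle ℝ F₁ E₁] [FiberBundle F₂ E₂] [VectorBundle ℝ F₂ E₂]
  [∀ x, IsTopologicalAddGroup (E₂ x)] [∀ x, ContinuousSMul ℝ (E₂ x)]
  {k : WithTop ℕ∞} {φ : ∀ x, E₁ x →L[ℝ] E₂ x} {x₀ : B}

/-- A section `φ` of a hom bundle with source of finite rank is smooth if it maps local sections that
are smooth to smooth ones: in a local frame its components are the coordinates of the images of
the frame. -/
theorem contMDiffAt_hom_of_apply [FiniteDimensional ℝ F₁] [ContMDiffVectorBundle k F₁ E₁ IB]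
    (h : ∀ X : (x : B) → E₁ x,
      (∀ᶠ x in 𝓝 x₀, ContMDiffAt IB (IB.prod 𝓘(ℝ, F₁)) k (fun y ↦ TotalSpace.mk' F₁ y (X y)) x) →
      ContMDiffAt IB (IB.prod 𝓘(ℝ, F₂)) k (fun y ↦ TotalSpace.mk' F₂ y (φ y (X y))) x₀) :
    ContMDiffAt IB (IB.prod 𝓘(ℝ, F₁ →L[ℝ] F₂)) k
      (fun y ↦ TotalSpace.mk' (F₁ →L[ℝ] F₂) (E := fun y ↦ E₁ y →L[ℝ] E₂ y) y (φ y)) x₀ := by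
  rw [contMDiffAt_hom_bundle]
  refine ⟨contMDiffAt_id, ?_⟩
  set t₁ := trivializationAt F₁ E₁ x₀
  set t₂ := trivializationAt F₂ E₂ x₀
  have hx₁ : x₀ ∈ t₁.baseSet := FiberBundle.mem_baseSet_trivializationAt' x₀
  have hx₂ : x₀ ∈ t₂.baseSet := FiberBundle.mem_baseSet_trivializationAt' x₀
  let b := Module.finBasis ℝ F₁
  have hs (i) : ContMDiffAt IB 𝓘(ℝ, F₂) k (fun y ↦ (t₂ ⟨y, φ y (t₁.localFrame b i y)⟩).2) x₀ := by
    have := h (t₁.localFrame b i) (by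
      filter_upwards [t₁.open_baseSet.mem_nhds hx₁] with y hy
      exact contMDiffAt_localFrame_of_mem k _ b i hy)
    rw [contMDiffAt_section] at this
    exact this
  have key : ContMDiffAt IB 𝓘(ℝ, F₁ →L[ℝ] F₂) k (fun y ↦ ∑ i,
      ContinuousLinearMap.smulRightL ℝ F₁ F₂ (LinearMap.toContinuousLinearMap (b.coord i))
        ((t₂ ⟨y, φ y (t₁.localFrame b i y)⟩).2)) x₀ := by
    refine contMDiffAt_finsetSum fun i _ ↦ ?_
    exact (ContinuousLinearMap.contMDiff _).contMDiffAt.comp x₀ (hs i)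
  refine key.congr_of_eventuallyEq ?_
  filter_upwards [t₁.open_baseSet.mem_nhds hx₁, t₂.open_baseSet.mem_nhds hx₂] with y h₁ h₂
  rw [ContinuousLinearMap.inCoordinates_eq h₁ h₂]
  set L := ((t₂.continuousLinearEquivAt ℝ y h₂ : E₂ y →L[ℝ] F₂).comp
    ((φ y).comp ((t₁.continuousLinearEquivAt ℝ y h₁).symm : F₁ →L[ℝ] E₁ y)))
  have hL (i) : (t₂ ⟨y, φ y (t₁.localFrame b i y)⟩).2 = L (b i) := by
    simp [L, t₁.localFrame_apply_of_mem_baseSet b h₁, Trivialization.basisAt]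
  ext v
  have hv : L v = ∑ i, b.repr v i • L (b i) := by
    simp only [← map_smul, ← map_sum, b.sum_repr]
  rw [hv]
  simp [hL]

omit [∀ x, IsTopologicalAddGroup (E₂ x)] [∀ x, ContinuousSMul ℝ (E₂ x)] in
theorem inCoordinates_isInvertible_iff {y : B}
    (h₁ : y ∈ (trivializationAt F₁ E₁ x₀).baseSet) (h₂ : y ∈ (trivializationAt F₂ E₂ x₀).baseSet) :
    (ContinuousLinearMap.inCoordinates F₁ E₁ F₂ E₂ x₀ y x₀ y (φ y)).IsInvertible ↔
      (φ y).IsInvertible := by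
  rw [ContinuousLinearMap.inCoordinates_eq h₁ h₂]
  simp

theorem eventually_isInvertible_of_contMDiffAt [CompleteSpace F₁]
    (hφ : ContMDiffAt IB (IB.prod 𝓘(ℝ, F₁ →L[ℝ] F₂)) k
      (fun y ↦ TotalSpace.mk' (F₁ →L[ℝ] F₂) (E := fun y ↦ E₁ y →L[ℝ] E₂ y) y (φ y)) x₀)
    (h : (φ x₀).IsInvertible) : ∀ᶠ y in 𝓝 x₀, (φ y).IsInvertible := by
  rw [contMDiffAt_hom_bundle] at hφ
  have hx₁ : x₀ ∈ (trivializationAt F₁ E₁ x₀).baseSet := FiberBundle.mem_baseSet_trivializationAt' x₀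
  have hx₂ : x₀ ∈ (trivializationAt F₂ E₂ x₀).baseSet := FiberBundle.mem_baseSet_trivializationAt' x₀
  obtain ⟨e, he⟩ := (inCoordinates_isInvertible_iff hx₁ hx₂).2 h
  have h1 := hφ.2.continuousAt.eventually (by
    dsimp only
    rw [← he]
    exact e.nhds)
  filter_upwards [h1, (trivializationAt F₁ E₁ x₀).open_baseSet.mem_nhds hx₁,
    (trivializationAt F₂ E₂ x₀).open_baseSet.mem_nhds hx₂] with y hy h₁ h₂
  exact (inCoordinates_isInvertible_iff h₁ h₂).1 hy

/-- If the smooth bundle map `φ` is invertible and `φ s` is smooth, then `s` is smooth. -/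
theorem contMDiffAt_of_hom_apply [CompleteSpace F₁] {s : ∀ x, E₁ x}
    (hφ : ContMDiffAt IB (IB.prod 𝓘(ℝ, F₁ →L[ℝ] F₂)) k
      (fun y ↦ TotalSpace.mk' (F₁ →L[ℝ] F₂) (E := fun y ↦ E₁ y →L[ℝ] E₂ y) y (φ y)) x₀)
    (h : (φ x₀).IsInvertible)
    (hs : ContMDiffAt IB (IB.prod 𝓘(ℝ, F₂)) k (fun y ↦ TotalSpace.mk' F₂ y (φ y (s y))) x₀) :
    ContMDiffAt IB (IB.prod 𝓘(ℝ, F₁)) k (fun y ↦ TotalSpace.mk' F₁ y (s y)) x₀ := by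
  have hev := eventually_isInvertible_of_contMDiffAt hφ h
  rw [contMDiffAt_hom_bundle] at hφ
  rw [contMDiffAt_section] at hs ⊢
  have hx₁ : x₀ ∈ (trivializationAt F₁ E₁ x₀).baseSet := FiberBundle.mem_baseSet_trivializationAt' x₀
  have hx₂ : x₀ ∈ (trivializationAt F₂ E₂ x₀).baseSet := FiberBundle.mem_baseSet_trivializationAt' x₀
  obtain ⟨e, he⟩ := (inCoordinates_isInvertible_iff hx₁ hx₂).2 h
  have hinv : ContMDiffAt IB 𝓘(ℝ, F₂ →L[ℝ] F₁) k (fun y ↦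
      (ContinuousLinearMap.inCoordinates F₁ E₁ F₂ E₂ x₀ y x₀ y (φ y)).inverse) x₀ := by
    refine ContMDiffAt.comp (I' := 𝓘(ℝ, F₁ →L[ℝ] F₂)) x₀ (g := ContinuousLinearMap.inverse) ?_ hφ.2
    rw [contMDiffAt_iff_contDiffAt, ← he]
    exact contDiffAt_map_inverse e
  refine (hinv.clm_apply hs).congr_of_eventuallyEq ?_
  filter_upwards [hev, (trivializationAt F₁ E₁ x₀).open_baseSet.mem_nhds hx₁,
    (trivializationAt F₂ E₂ x₀).open_baseSet.mem_nhds hx₂] with y hy h₁ h₂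
  obtain ⟨e', he'⟩ := (inCoordinates_isInvertible_iff h₁ h₂).2 hy
  rw [← he', ContinuousLinearMap.inverse_equiv]
  symm
  rw [ContinuousLinearEquiv.coe_coe, ContinuousLinearEquiv.symm_apply_eq,
    ← ContinuousLinearEquiv.coe_coe, he', ContinuousLinearMap.inCoordinates_eq h₁ h₂]
  simp [Trivialization.symm_apply_apply_mk _ h₁]

end HomSections

/-! ### Vector, covector and tensor fields that are smooth at a point -/

section Smooth

variable {n : ℕ} {N : Type u} [TopologicalSpace N]
  [ChartedSpace (EuclideanSpace ℝ (Fin n)) N] [IsManifold (𝓡 n) ∞ N]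

/-- The covector field `ℓ` is smooth at the point `x`. -/
def SmoothCovectorAt (ℓ : CovectorField n N) (x : N) : Prop :=
  ContMDiffAt (𝓡 n) ((𝓡 n).prod 𝓘(ℝ, EuclideanSpace ℝ (Fin n) →L[ℝ] ℝ)) ∞
    (fun x ↦ Bundle.TotalSpace.mk' (EuclideanSpace ℝ (Fin n) →L[ℝ] ℝ)
      (E := fun x : N ↦ TangentSpace (𝓡 n) x →L[ℝ] ℝ) x (ℓ x)) x

/-- The `(0,2)`-tensor field `γ` is smooth at the point `x`. -/
def SmoothTensorAt (γ : TensorField n N) (x : N) : Prop :=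
  ContMDiffAt (𝓡 n) ((𝓡 n).prod
      𝓘(ℝ, EuclideanSpace ℝ (Fin n) →L[ℝ] EuclideanSpace ℝ (Fin n) →L[ℝ] ℝ)) ∞
    (fun x ↦ Bundle.TotalSpace.mk'
      (EuclideanSpace ℝ (Fin n) →L[ℝ] EuclideanSpace ℝ (Fin n) →L[ℝ] ℝ)
      (E := fun x : N ↦ TangentSpace (𝓡 n) x →L[ℝ] TangentSpace (𝓡 n) x →L[ℝ] ℝ) x (γ x)) x

variable {U : Set N} {x : N} {γ : TensorField n N} {ℓ : CovectorField n N} {X Z : VField n N}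

theorem SmoothFieldOn.smoothFieldAt (h : SmoothFieldOn X U) (hU : U ∈ 𝓝 x) : SmoothFieldAt X x :=
  ContMDiffOn.contMDiffAt h hU

theorem SmoothCovectorOn.smoothCovectorAt (h : SmoothCovectorOn ℓ U) (hU : U ∈ 𝓝 x) :
    SmoothCovectorAt ℓ x :=
  ContMDiffOn.contMDiffAt h hU

theorem SmoothTensorOn.smoothTensorAt (h : SmoothTensorOn γ U) (hU : U ∈ 𝓝 x) :
    SmoothTensorAt γ x :=
  ContMDiffOn.contMDiffAt h hU

theorem SmoothCovectorAt.of_apply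
    (h : ∀ X : VField n N, (∀ᶠ y in 𝓝 x, SmoothFieldAt X y) →
      ContMDiffAt (𝓡 n) 𝓘(ℝ, ℝ) ∞ (fun y ↦ ℓ y (X y)) x) : SmoothCovectorAt ℓ x := by
  refine contMDiffAt_hom_of_apply (E₁ := (TangentSpace (𝓡 n) : N → Type _))
    (E₂ := Bundle.Trivial N ℝ) (φ := ℓ) fun X hX ↦ ?_
  rw [contMDiffAt_section]
  exact h X hX

theorem SmoothTensorAt.of_apply
    (h : ∀ X Z : VField n N, (∀ᶠ y in 𝓝 x, SmoothFieldAt X y) → (∀ᶠ y in 𝓝 x, SmoothFieldAt Z y) →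
      ContMDiffAt (𝓡 n) 𝓘(ℝ, ℝ) ∞ (fun y ↦ γ y (X y) (Z y)) x) : SmoothTensorAt γ x := by
  refine contMDiffAt_hom_of_apply (E₁ := (TangentSpace (𝓡 n) : N → Type _))
    (E₂ := fun y : N ↦ TangentSpace (𝓡 n) y →L[ℝ] ℝ) (φ := γ) fun X hX ↦ ?_
  exact SmoothCovectorAt.of_apply fun Z hZ ↦ h X Z hX hZ

theorem SmoothCovectorAt.apply (h : SmoothCovectorAt ℓ x) (hX : SmoothFieldAt X x) :
    ContMDiffAt (𝓡 n) 𝓘(ℝ, ℝ) ∞ (fun y ↦ ℓ y (X y)) x := by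
  have := ContMDiffAt.clm_bundle_apply (E₁ := (TangentSpace (𝓡 n) : N → Type _))
    (E₂ := Bundle.Trivial N ℝ) (ϕ := ℓ) h hX
  rw [contMDiffAt_section] at this
  exact this

theorem SmoothTensorAt.apply (h : SmoothTensorAt γ x) (hX : SmoothFieldAt X x) :
    SmoothCovectorAt (fun y ↦ γ y (X y)) x :=
  ContMDiffAt.clm_bundle_apply (E₁ := (TangentSpace (𝓡 n) : N → Type _))
    (E₂ := fun y : N ↦ TangentSpace (𝓡 n) y →L[ℝ] ℝ) (ϕ := γ) h hX

theorem SmoothTensorAt.apply₂ (h : SmoothTensorAt γ x) (hX : SmoothFieldAt X x)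
    (hZ : SmoothFieldAt Z x) : ContMDiffAt (𝓡 n) 𝓘(ℝ, ℝ) ∞ (fun y ↦ γ y (X y) (Z y)) x :=
  (h.apply hX).apply hZ

/-- The differentiability counterpart of `SmoothFieldAt`. -/
abbrev DiffFieldAt (X : VField n N) (x : N) : Prop :=
  MDifferentiableAt (𝓡 n) ((𝓡 n).prod 𝓘(ℝ, EuclideanSpace ℝ (Fin n)))
    (fun y ↦ Bundle.TotalSpace.mk' (EuclideanSpace ℝ (Fin n)) y (X y)) x

theorem SmoothFieldAt.diffFieldAt (h : SmoothFieldAt X x) : DiffFieldAt X x :=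
  ContMDiffAt.mdifferentiableAt h (by simp)

theorem SmoothCovectorAt.mdifferentiableAt_apply (h : SmoothCovectorAt ℓ x) (hX : DiffFieldAt X x) :
    MDifferentiableAt (𝓡 n) 𝓘(ℝ, ℝ) (fun y ↦ ℓ y (X y)) x := by
  have := MDifferentiableAt.clm_bundle_apply (E₁ := (TangentSpace (𝓡 n) : N → Type _))
    (E₂ := Bundle.Trivial N ℝ) (ϕ := ℓ) (ContMDiffAt.mdifferentiableAt h (by simp)) hX
  rw [mdifferentiableAt_section] at this
  exact this

theorem SmoothTensorAt.mdifferentiableAt_apply₂ (h : SmoothTensorAt γ x) (hX : DiffFieldAt X x)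
    (hZ : DiffFieldAt Z x) : MDifferentiableAt (𝓡 n) 𝓘(ℝ, ℝ) (fun y ↦ γ y (X y) (Z y)) x := by
  have h1 := MDifferentiableAt.clm_bundle_apply (E₁ := (TangentSpace (𝓡 n) : N → Type _))
    (E₂ := fun y : N ↦ TangentSpace (𝓡 n) y →L[ℝ] ℝ)
    (ϕ := γ) (ContMDiffAt.mdifferentiableAt h (by simp)) hX
  have := MDifferentiableAt.clm_bundle_apply (E₁ := (TangentSpace (𝓡 n) : N → Type _))
    (E₂ := Bundle.Trivial N ℝ) (ϕ := fun y ↦ γ y (X y)) h1 hZ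
  rw [mdifferentiableAt_section] at this
  exact this

/-- Used to check identities between tensors on smooth vector fields. -/
theorem exists_smooth_extension (v : TangentSpace (𝓡 n) x) :
    ∃ X : VField n N, (∀ᶠ y in 𝓝 x, SmoothFieldAt X y) ∧ X x = v := by
  obtain ⟨s, hs, h⟩ := FiberBundle.exists_contMDiffOn_extend (k := ∞) (𝓡 n)
    (EuclideanSpace ℝ (Fin n)) (V := (TangentSpace (𝓡 n) : N → Type _)) v
  refine ⟨FiberBundle.extend (EuclideanSpace ℝ (Fin n)) v, ?_, FiberBundle.extend_apply_self _ v⟩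
  filter_upwards [eventually_mem_nhds_iff.2 hs] with y hy
  exact h.contMDiffAt hy

end Smooth

/-! ### Transversality of a covector to the radical -/

/-- A bilinear form with trivial left kernel on a finite-dimensional space is non-degenerate. -/
theorem isInvertible_of_injective {E : Type*} [NormedAddCommGroup E] [NormedSpace ℝ E]
    [FiniteDimensional ℝ E] (L : E →L[ℝ] E →L[ℝ] ℝ) (hL : ∀ v, L v = 0 → v = 0) :
    L.IsInvertible := by
  have hinj : Function.Injective L.toLinearMap :=
    (injective_iff_map_eq_zero _).2 hL
  have hdim : Module.finrank ℝ E = Module.finrank ℝ (E →L[ℝ] ℝ) := by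
    rw [← (LinearMap.toContinuousLinearMap (𝕜 := ℝ) (E := E) (F' := ℝ)).finrank_eq]
    exact (Subspace.dual_finrank_eq).symm
  refine ⟨(LinearEquiv.ofInjectiveOfFinrankEq L.toLinearMap hinj hdim).toContinuousLinearEquiv, ?_⟩
  ext v
  rfl

section Data

variable {n : ℕ} {N : Type u} [TopologicalSpace N]
  [ChartedSpace (EuclideanSpace ℝ (Fin n)) N]

/-- The pointwise algebraic content of null metric hypersurface data: `γ` is symmetric, its radical
contains a vector on which `ℓ` is `1`, and `ℓ` is injective on the radical. The scalar `ℓ⁽²⁾` plays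
no role: given a one-dimensional radical these conditions are equivalent to the non-degeneracy of
`𝒜`. -/
structure TransverseAt (γ : TensorField n N) (ℓ : CovectorField n N) (x : N) : Prop where
  symm : ∀ v w, γ x v w = γ x w v
  exists_null : ∃ v, γ x v = 0 ∧ ℓ x v = 1
  eq_zero : ∀ v, γ x v = 0 → ℓ x v = 0 → v = 0

/-- The symmetric form `γ + ℓ ⊗ ℓ`. It is non-degenerate when `ℓ` is transverse to the radical. -/
def completedForm (γ : TensorField n N) (ℓ : CovectorField n N) : TensorField n N :=
  fun x ↦ γ x + (ℓ x).smulRight (ℓ x)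

variable {U : Set N} {x : N} {γ : TensorField n N} {ℓ : CovectorField n N} {ℓ₂ : N → ℝ}
  {X Z : VField n N}

@[simp]
theorem completedForm_apply (v w : TangentSpace (𝓡 n) x) :
    completedForm γ ℓ x v w = γ x v w + ℓ x v * ℓ x w := rfl

namespace TransverseAt

theorem nullVector_spec (h : TransverseAt γ ℓ x) :
    γ x (nullVector γ ℓ x) = 0 ∧ ℓ x (nullVector γ ℓ x) = 1 :=
  Classical.epsilon_spec (p := fun v : TangentSpace (𝓡 n) x ↦ γ x v = 0 ∧ ℓ x v = 1) h.exists_null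

theorem eq_nullVector (h : TransverseAt γ ℓ x) {v : TangentSpace (𝓡 n) x}
    (h₁ : γ x v = 0) (h₂ : ℓ x v = 1) : nullVector γ ℓ x = v := by
  refine sub_eq_zero.1 (h.eq_zero _ ?_ ?_) <;> simp [h.nullVector_spec, h₁, h₂]

theorem isInvertible (h : TransverseAt γ ℓ x) : (completedForm γ ℓ x).IsInvertible := by
  refine isInvertible_of_injective (E := EuclideanSpace ℝ (Fin n)) (completedForm γ ℓ x)
    fun (v : TangentSpace (𝓡 n) x) hv ↦ ?_
  have hv' (w : TangentSpace (𝓡 n) x) : γ x v w + ℓ x v * ℓ x w = 0 := by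
    rw [← completedForm_apply]
    exact congrArg (fun L : TangentSpace (𝓡 n) x →L[ℝ] ℝ ↦ L w) hv
  have h1 := hv' (nullVector γ ℓ x)
  rw [h.symm, h.nullVector_spec.1, h.nullVector_spec.2] at h1
  have h2 : ℓ x v = 0 := by simpa using h1
  refine h.eq_zero v (ContinuousLinearMap.ext fun w ↦ ?_) h2
  simpa [h2] using hv' w

theorem completedForm_nullVector (h : TransverseAt γ ℓ x) :
    completedForm γ ℓ x (nullVector γ ℓ x) = ℓ x := by
  ext w
  simp [h.nullVector_spec]

theorem neg (h : TransverseAt γ ℓ x) : TransverseAt γ (-ℓ) x where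
  symm := h.symm
  exists_null := ⟨-nullVector γ ℓ x, by simp [h.nullVector_spec]⟩
  eq_zero v h₁ h₂ := h.eq_zero v h₁ (by simpa using h₂)

theorem nullVector_neg (h : TransverseAt γ ℓ x) :
    nullVector γ (-ℓ) x = -nullVector γ ℓ x :=
  h.neg.eq_nullVector (by simp [h.nullVector_spec]) (by simp [h.nullVector_spec])

end TransverseAt

theorem transverseAt_of_radical (hsymm : ∀ v w, γ x v w = γ x w v)
    (hrad : Module.finrank ℝ (radical γ x) = 1) {v : TangentSpace (𝓡 n) x}
    (hv : γ x v = 0) (hℓ : ℓ x v ≠ 0) : TransverseAt γ ℓ x where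
  symm := hsymm
  exists_null := ⟨(ℓ x v)⁻¹ • v, by simp [hv], by simp [hℓ]⟩
  eq_zero w hw hℓw := by
    have hv0 : (⟨v, hv⟩ : radical γ x) ≠ 0 := by
      rintro h
      apply hℓ
      rw [show v = 0 from congrArg Subtype.val h, map_zero]
    obtain ⟨c, hc⟩ := (finrank_eq_one_iff_of_nonzero' _ hv0).1 hrad ⟨w, hw⟩
    have hc' : c • v = w := congrArg Subtype.val hc
    rw [← hc'] at hℓw ⊢
    have : c = 0 := by simpa [hℓ] using hℓw
    simp [this]

theorem exists_radical_ne_zero (hrad : Module.finrank ℝ (radical γ x) = 1) :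
    ∃ v : TangentSpace (𝓡 n) x, γ x v = 0 ∧ v ≠ 0 := by
  obtain ⟨⟨v, hv⟩, h0, -⟩ := finrank_eq_one_iff'.1 hrad
  exact ⟨v, hv, fun h ↦ h0 (Subtype.ext h)⟩

theorem exists_smul_of_radical (hrad : Module.finrank ℝ (radical γ x) = 1)
    {v w : TangentSpace (𝓡 n) x} (hv : γ x v = 0) (hv0 : v ≠ 0) (hw : γ x w = 0) :
    ∃ c : ℝ, w = c • v := by
  have hv0' : (⟨v, hv⟩ : radical γ x) ≠ 0 := fun h ↦ hv0 (congrArg Subtype.val h)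
  obtain ⟨c, hc⟩ := (finrank_eq_one_iff_of_nonzero' _ hv0').1 hrad ⟨w, hw⟩
  exact ⟨c, (congrArg Subtype.val hc).symm⟩

variable [IsManifold (𝓡 n) ∞ N]

theorem IsNullDataOn.transverseAt (h : IsNullDataOn γ ℓ ℓ₂ U) (hx : x ∈ U) :
    TransverseAt γ ℓ x := by
  obtain ⟨v, hv, hv0⟩ := exists_radical_ne_zero (h.null.finrank_radical x hx)
  refine transverseAt_of_radical (h.null.symm x hx) (h.null.finrank_radical x hx) hv fun hℓ ↦ hv0 ?_
  have := h.nondegenerate x hx (v, 0) fun q ↦ by simp [ambientForm, hv, hℓ]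
  exact congrArg Prod.fst this

theorem IsNullDataOn.of_transverseAt (hγ : IsNullOn γ U) (hℓ : SmoothCovectorOn ℓ U)
    (hℓ₂ : ContMDiffOn (𝓡 n) 𝓘(ℝ, ℝ) ∞ ℓ₂ U) (h : ∀ x ∈ U, TransverseAt γ ℓ x) :
    IsNullDataOn γ ℓ ℓ₂ U where
  null := hγ
  smooth_covector := hℓ
  smooth_scalar := hℓ₂
  nondegenerate := by
    rintro x hx ⟨v, a⟩ hq
    have ht := h x hx
    have ha : a = 0 := by
      have := hq (nullVector γ ℓ x, 0)
      rw [ambientForm, ht.symm] at this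
      simpa [ht.nullVector_spec] using this
    subst ha
    have hℓv : ℓ x v = 0 := by simpa [ambientForm] using hq (0, 1)
    have : v = 0 := ht.eq_zero v (ContinuousLinearMap.ext fun w ↦ by
      simpa [ambientForm] using hq (w, 0)) hℓv
    simp [this]

theorem IsNullOn.mono {V : Set N} (h : IsNullOn γ U) (hVU : V ⊆ U) : IsNullOn γ V where
  smooth := ContMDiffOn.mono h.smooth hVU
  symm x hx := h.symm x (hVU hx)
  finrank_radical x hx := h.finrank_radical x (hVU hx)

theorem SmoothTensorAt.completedForm (hγ : SmoothTensorAt γ x) (hℓ : SmoothCovectorAt ℓ x) :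
    SmoothTensorAt (NullGeometry.completedForm γ ℓ) x := by
  refine SmoothTensorAt.of_apply fun X Z hX hZ ↦ ?_
  exact (hγ.apply₂ hX.self_of_nhds hZ.self_of_nhds).add
    ((hℓ.apply hX.self_of_nhds).mul (hℓ.apply hZ.self_of_nhds))

theorem SmoothTensorAt.eventually_isInvertible (hG : SmoothTensorAt γ x)
    (h : (γ x).IsInvertible) : ∀ᶠ y in 𝓝 x, (γ y).IsInvertible :=
  eventually_isInvertible_of_contMDiffAt (E₁ := (TangentSpace (𝓡 n) : N → Type _))
    (E₂ := fun y : N ↦ TangentSpace (𝓡 n) y →L[ℝ] ℝ) (φ := γ) hG h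

theorem SmoothTensorAt.smoothFieldAt_of_apply (hG : SmoothTensorAt γ x) (h : (γ x).IsInvertible)
    (hX : SmoothCovectorAt (fun y ↦ γ y (X y)) x) : SmoothFieldAt X x :=
  contMDiffAt_of_hom_apply (E₁ := (TangentSpace (𝓡 n) : N → Type _))
    (E₂ := fun y : N ↦ TangentSpace (𝓡 n) y →L[ℝ] ℝ) (φ := γ) hG h hX

/-- The field `n` is the covector `ℓ` with its index raised by `γ + ℓ ⊗ ℓ`, so it is smooth although
it is defined by a pointwise choice. -/
theorem smoothFieldAt_nullVector (hγ : SmoothTensorAt γ x) (hℓ : SmoothCovectorAt ℓ x)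
    (h : ∀ᶠ y in 𝓝 x, TransverseAt γ ℓ y) : SmoothFieldAt (nullVector γ ℓ) x := by
  refine (hγ.completedForm hℓ).smoothFieldAt_of_apply h.self_of_nhds.isInvertible ?_
  refine ContMDiffAt.congr_of_eventuallyEq hℓ ?_
  filter_upwards [h] with y hy
  rw [hy.completedForm_nullVector]

end Data

/-! ### Smoothness of derivatives and Lie brackets -/

section Derivative

variable {n : ℕ} {N : Type u} [TopologicalSpace N]
  [ChartedSpace (EuclideanSpace ℝ (Fin n)) N] [IsManifold (𝓡 n) ∞ N]
  {x : N} {X Z : VField n N}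

theorem contMDiffAt_mfderiv_apply {E' H' M' : Type*} [NormedAddCommGroup E'] [NormedSpace ℝ E']
    [TopologicalSpace H'] {I' : ModelWithCorners ℝ E' H'} [TopologicalSpace M'] [ChartedSpace H' M']
    [IsManifold I' ∞ M'] {f : N → M'} (hf : ContMDiffAt (𝓡 n) I' ∞ f x) (hX : SmoothFieldAt X x) :
    ContMDiffAt (𝓡 n) (I'.prod 𝓘(ℝ, E')) ∞
      (fun y ↦ TotalSpace.mk' E' (E := (TangentSpace I' : M' → Type _)) (f y)
        (mfderiv (𝓡 n) I' f y (X y))) x := by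
  have h := hf.mfderiv_const (m := ∞) (by simp)
  exact ContMDiffAt.clm_apply_of_inCoordinates (b₁ := id) (b₂ := f)
    (E₁ := (TangentSpace (𝓡 n) : N → Type _)) (E₂ := (TangentSpace I' : M' → Type _))
    (ϕ := fun y ↦ mfderiv (𝓡 n) I' f y) (v := X) h hX hf

theorem contMDiffAt_mvfderiv_apply {f : N → ℝ} (hf : ContMDiffAt (𝓡 n) 𝓘(ℝ, ℝ) ∞ f x)
    (hX : SmoothFieldAt X x) :
    ContMDiffAt (𝓡 n) 𝓘(ℝ, ℝ) ∞ (fun y ↦ mvfderiv (𝓡 n) f y (X y)) x := by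
  have := contMDiffAt_mfderiv_apply hf hX
  rw [contMDiffAt_totalSpace] at this
  have h2 := this.2
  simp only [trivializationAt_model_space_apply] at h2
  exact h2

/-- The regularity under which Mathlib proves the identities of the Lie bracket. -/
scoped instance isManifold_minSmoothness_two : IsManifold (𝓡 n) (minSmoothness ℝ 2) N := by
  rw [minSmoothness_of_isRCLikeNormedField]
  infer_instance

theorem smoothFieldAt_mlieBracket (hX : SmoothFieldAt X x) (hZ : SmoothFieldAt Z x) :
    SmoothFieldAt (mlieBracket (𝓡 n) X Z) x := by
  have : IsManifold (𝓡 n) (((⊤ : ℕ∞) : WithTop ℕ∞) + 1) N := by simpa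
  exact ContMDiffAt.mlieBracket_vectorField (m := ⊤) (n := ⊤) hX hZ (by simp)

end Derivative

/-! ### The Koszul equations -/

section Koszul

variable {n : ℕ} {N : Type u} [TopologicalSpace N]
  [ChartedSpace (EuclideanSpace ℝ (Fin n)) N] [IsManifold (𝓡 n) ∞ N]
  {U : Set N} {x : N} {γ : TensorField n N} {ℓ : CovectorField n N} {ℓ₂ : N → ℝ}
  {X Z W : VField n N}

/-- The right-hand side of the Koszul formula of `γ`. -/
def koszul (γ : TensorField n N) (X Z W : VField n N) (x : N) : ℝ :=
  (1 / 2) * (mvfderiv (𝓡 n) (fun y ↦ γ y (Z y) (W y)) x (X x)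
    + mvfderiv (𝓡 n) (fun y ↦ γ y (X y) (W y)) x (Z x)
    - mvfderiv (𝓡 n) (fun y ↦ γ y (X y) (Z y)) x (W x)
    + γ x (mlieBracket (𝓡 n) X Z x) (W x)
    - γ x (mlieBracket (𝓡 n) X W x) (Z x)
    - γ x (mlieBracket (𝓡 n) Z W x) (X x))

/-- The counterpart for a covector field `ℓ` of the right-hand side of the Koszul formula. Only the
symmetric part of `∇ℓ` is prescribed for a metric hypersurface connection, and its antisymmetric
part is `dℓ` because the torsion vanishes. -/
def koszulCovector (ℓ : CovectorField n N) (X Z : VField n N) (x : N) : ℝ :=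
  (1 / 2) * (mvfderiv (𝓡 n) (fun y ↦ ℓ y (Z y)) x (X x)
    + mvfderiv (𝓡 n) (fun y ↦ ℓ y (X y)) x (Z x)
    + ℓ x (mlieBracket (𝓡 n) X Z x))

/-- The Koszul equations for the operator `D Z = (∇Z)|_x` at the point `x`: the values of `γ(∇_X Z, W)`
and `ℓ(∇_X Z)` for a metric hypersurface connection `∇`. They determine `∇` on smooth fields. -/
structure SatisfiesKoszulAt (γ : TensorField n N) (ℓ : CovectorField n N) (ℓ₂ : N → ℝ) (x : N)
    (D : VField n N → TangentSpace (𝓡 n) x →L[ℝ] TangentSpace (𝓡 n) x) : Prop where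
  gamma : ∀ X Z W : VField n N, SmoothFieldAt X x → SmoothFieldAt Z x → SmoothFieldAt W x →
    γ x (D Z (X x)) (W x) = koszul γ X Z W x + tensorU γ ℓ X Z x * ℓ x (W x)
  ell : ∀ X Z : VField n N, SmoothFieldAt X x → SmoothFieldAt Z x →
    ℓ x (D Z (X x)) = koszulCovector ℓ X Z x + ℓ₂ x * tensorU γ ℓ X Z x

omit [IsManifold (𝓡 n) ∞ N] in
theorem tensorU_comm (hγ : ∀ᶠ y in 𝓝 x, ∀ v w, γ y v w = γ y w v) :
    tensorU γ ℓ X Z x = tensorU γ ℓ Z X x := by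
  have h : mvfderiv (𝓡 n) (fun y ↦ γ y (X y) (Z y)) x = mvfderiv (𝓡 n) (fun y ↦ γ y (Z y) (X y)) x := by
    have : (fun y ↦ γ y (X y) (Z y)) =ᶠ[𝓝 x] (fun y ↦ γ y (Z y) (X y)) := hγ.mono fun y hy ↦ hy _ _
    exact this.mfderiv_eq
  rw [tensorU, tensorU, lieDerivative, lieDerivative, h, hγ.self_of_nhds _ (Z x),
    hγ.self_of_nhds (X x)]
  ring

/-- The Koszul formula: the three cyclic permutations of the equation for `∇γ` are combined and the
torsion is eliminated. -/
theorem satisfiesKoszulAt_of_conditions {cov : RawConnection n N}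
    (hγ : ∀ᶠ y in 𝓝 x, ∀ v w, γ y v w = γ y w v)
    (torsionFree : ∀ X Z : VField n N, SmoothFieldAt X x → SmoothFieldAt Z x →
      cov Z x (X x) - cov X x (Z x) = VectorField.mlieBracket (𝓡 n) X Z x)
    (cov_gamma : ∀ X Z W : VField n N,
      SmoothFieldAt X x → SmoothFieldAt Z x → SmoothFieldAt W x →
      covTensor cov γ X Z W x =
        - tensorU γ ℓ X Z x * ℓ x (W x) - tensorU γ ℓ X W x * ℓ x (Z x))
    (cov_ell : ∀ X Z : VField n N, SmoothFieldAt X x → SmoothFieldAt Z x →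
      covCovector cov ℓ X Z x + covCovector cov ℓ Z X x = - 2 * ℓ₂ x * tensorU γ ℓ X Z x) :
    SatisfiesKoszulAt γ ℓ ℓ₂ x (fun Z ↦ cov Z x) where
  gamma X Z W hX hZ hW := by
    have h1 := cov_gamma X Z W hX hZ hW
    have h2 := cov_gamma Z X W hZ hX hW
    have h3 := cov_gamma W X Z hW hX hZ
    have t1 := congrArg (fun v ↦ γ x v (W x)) (torsionFree X Z hX hZ)
    have t2 := congrArg (fun v ↦ γ x v (Z x)) (torsionFree X W hX hW)
    have t3 := congrArg (fun v ↦ γ x v (X x)) (torsionFree Z W hZ hW)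
    simp only [map_sub, sub_apply] at t1 t2 t3
    have s := hγ.self_of_nhds
    simp only [covTensor] at h1 h2 h3
    rw [s (Z x)] at h1
    rw [s (X x)] at h2
    rw [s (X x)] at h3
    rw [tensorU_comm (X := Z) (Z := X) hγ] at h2
    rw [tensorU_comm (X := W) (Z := X) hγ, tensorU_comm (X := W) (Z := Z) hγ] at h3
    rw [koszul]
    linear_combination (1/2) * (-h1 - h2 + h3 + t1 - t2 - t3)
  ell X Z hX hZ := by
    have h1 := cov_ell X Z hX hZ
    have t1 := congrArg (ℓ x) (torsionFree X Z hX hZ)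
    simp only [map_sub] at t1
    simp only [covCovector] at h1
    rw [koszulCovector]
    linear_combination (1/2) * (-h1 + t1)

namespace SatisfiesKoszulAt

variable {D : VField n N → TangentSpace (𝓡 n) x →L[ℝ] TangentSpace (𝓡 n) x}

theorem eq_of_transverseAt
    (h : SatisfiesKoszulAt γ ℓ ℓ₂ x D)
    {D' : VField n N → TangentSpace (𝓡 n) x →L[ℝ] TangentSpace (𝓡 n) x}
    (h' : SatisfiesKoszulAt γ ℓ ℓ₂ x D') (ht : TransverseAt γ ℓ x) (hZ : SmoothFieldAt Z x) :
    D Z = D' Z := by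
  ext v
  obtain ⟨X, hX, rfl⟩ := exists_smooth_extension v
  refine sub_eq_zero.1 (ht.eq_zero _ (ContinuousLinearMap.ext fun w ↦ ?_) ?_)
  · obtain ⟨W, hW, rfl⟩ := exists_smooth_extension w
    simp only [map_sub, sub_apply, zero_apply]
    rw [h.gamma X Z W hX.self_of_nhds hZ hW.self_of_nhds,
      h'.gamma X Z W hX.self_of_nhds hZ hW.self_of_nhds, sub_self]
  · rw [map_sub, h.ell X Z hX.self_of_nhds hZ, h'.ell X Z hX.self_of_nhds hZ, sub_self]

/-- The converse of `satisfiesKoszulAt_of_conditions`. -/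
theorem conditions {cov : RawConnection n N}
    (h : SatisfiesKoszulAt γ ℓ ℓ₂ x (fun Z ↦ cov Z x)) (ht : TransverseAt γ ℓ x)
    (hγ : ∀ᶠ y in 𝓝 x, ∀ v w, γ y v w = γ y w v) :
    (∀ X Z : VField n N, SmoothFieldAt X x → SmoothFieldAt Z x →
      cov Z x (X x) - cov X x (Z x) = VectorField.mlieBracket (𝓡 n) X Z x) ∧
    (∀ X Z W : VField n N,
      SmoothFieldAt X x → SmoothFieldAt Z x → SmoothFieldAt W x →
      covTensor cov γ X Z W x =
        - tensorU γ ℓ X Z x * ℓ x (W x) - tensorU γ ℓ X W x * ℓ x (Z x)) ∧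
    (∀ X Z : VField n N, SmoothFieldAt X x → SmoothFieldAt Z x →
      covCovector cov ℓ X Z x + covCovector cov ℓ Z X x = - 2 * ℓ₂ x * tensorU γ ℓ X Z x) := by
  have s := hγ.self_of_nhds
  have hsymm (X Z : VField n N) : mvfderiv (𝓡 n) (fun y ↦ γ y (X y) (Z y)) x =
      mvfderiv (𝓡 n) (fun y ↦ γ y (Z y) (X y)) x := by
    have : (fun y ↦ γ y (X y) (Z y)) =ᶠ[𝓝 x] (fun y ↦ γ y (Z y) (X y)) := hγ.mono fun y hy ↦ hy _ _
    exact this.mfderiv_eq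
  have hbr (X Z : VField n N) : mlieBracket (𝓡 n) Z X x = - mlieBracket (𝓡 n) X Z x :=
    mlieBracket_swap_apply
  refine ⟨fun X Z hX hZ ↦ sub_eq_zero.1 (ht.eq_zero _ (ContinuousLinearMap.ext fun w ↦ ?_) ?_),
    fun X Z W hX hZ hW ↦ ?_, fun X Z hX hZ ↦ ?_⟩
  · obtain ⟨W, hW, rfl⟩ := exists_smooth_extension w
    have h1 := h.gamma X Z W hX hZ hW.self_of_nhds
    have h2 := h.gamma Z X W hZ hX hW.self_of_nhds
    rw [koszul] at h1 h2
    rw [hbr X Z, tensorU_comm hγ, hsymm Z X] at h2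
    simp only [map_sub, map_neg, sub_apply, neg_apply,
      zero_apply] at h1 h2 ⊢
    linear_combination h1 - h2
  · have h1 := h.ell X Z hX hZ
    have h2 := h.ell Z X hZ hX
    rw [koszulCovector] at h1 h2
    rw [hbr X Z, tensorU_comm hγ] at h2
    simp only [map_sub, map_neg] at h1 h2 ⊢
    linear_combination h1 - h2
  · have h1 := h.gamma X Z W hX hZ hW
    have h2 := h.gamma X W Z hX hW hZ
    rw [koszul] at h1 h2
    rw [hbr Z W, hsymm W Z, map_neg, neg_apply] at h2
    rw [covTensor, s (Z x)]
    linear_combination -h1 - h2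
  · have h1 := h.ell X Z hX hZ
    have h2 := h.ell Z X hZ hX
    rw [koszulCovector] at h1 h2
    rw [hbr X Z, tensorU_comm hγ, map_neg] at h2
    rw [covCovector, covCovector]
    linear_combination -h1 - h2

end SatisfiesKoszulAt

end Koszul

/-! ### Tensoriality of the Koszul expressions -/

section Tensoriality

variable {n : ℕ} {N : Type u} [TopologicalSpace N]
  [ChartedSpace (EuclideanSpace ℝ (Fin n)) N] [IsManifold (𝓡 n) ∞ N]
  {U : Set N} {x : N} {γ : TensorField n N} {ℓ : CovectorField n N} {ℓ₂ : N → ℝ}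
  {X X' Z Z' W W' V : VField n N} {g : N → ℝ}

theorem DiffFieldAt.smul (hg : MDifferentiableAt (𝓡 n) 𝓘(ℝ, ℝ) g x) (hX : DiffFieldAt X x) :
    DiffFieldAt (g • X) x := hg.smul_section hX

theorem DiffFieldAt.add (hX : DiffFieldAt X x) (hX' : DiffFieldAt X' x) :
    DiffFieldAt (X + X') x := mdifferentiableAt_add_section hX hX'

theorem mvfderiv_covector_smul (hℓ : SmoothCovectorAt ℓ x)
    (hg : MDifferentiableAt (𝓡 n) 𝓘(ℝ, ℝ) g x) (hX : DiffFieldAt X x) (v : TangentSpace (𝓡 n) x) :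
    mvfderiv (𝓡 n) (fun y ↦ ℓ y ((g • X) y)) x v =
      g x * mvfderiv (𝓡 n) (fun y ↦ ℓ y (X y)) x v + mvfderiv (𝓡 n) g x v * ℓ x (X x) := by
  simp only [Pi.smul_apply', map_smul, smul_eq_mul]
  rw [mvfderiv_fun_mul hg (hℓ.mdifferentiableAt_apply hX)]
  simp only [add_apply, smul_apply, smul_eq_mul]
  ring

theorem mvfderiv_covector_add (hℓ : SmoothCovectorAt ℓ x)
    (hX : DiffFieldAt X x) (hX' : DiffFieldAt X' x) (v : TangentSpace (𝓡 n) x) :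
    mvfderiv (𝓡 n) (fun y ↦ ℓ y ((X + X') y)) x v =
      mvfderiv (𝓡 n) (fun y ↦ ℓ y (X y)) x v + mvfderiv (𝓡 n) (fun y ↦ ℓ y (X' y)) x v := by
  simp only [Pi.add_apply, map_add]
  rw [mvfderiv_fun_add (hℓ.mdifferentiableAt_apply hX) (hℓ.mdifferentiableAt_apply hX')]
  rfl

theorem mvfderiv_tensor_smul_left (hγ : SmoothTensorAt γ x)
    (hg : MDifferentiableAt (𝓡 n) 𝓘(ℝ, ℝ) g x) (hX : DiffFieldAt X x) (hZ : DiffFieldAt Z x)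
    (v : TangentSpace (𝓡 n) x) :
    mvfderiv (𝓡 n) (fun y ↦ γ y ((g • X) y) (Z y)) x v =
      g x * mvfderiv (𝓡 n) (fun y ↦ γ y (X y) (Z y)) x v
        + mvfderiv (𝓡 n) g x v * γ x (X x) (Z x) := by
  simp only [Pi.smul_apply', map_smul, smul_eq_mul, smul_apply]
  rw [mvfderiv_fun_mul hg (hγ.mdifferentiableAt_apply₂ hX hZ)]
  simp only [add_apply, smul_apply, smul_eq_mul]
  ring

theorem mvfderiv_tensor_smul_right (hγ : SmoothTensorAt γ x)
    (hg : MDifferentiableAt (𝓡 n) 𝓘(ℝ, ℝ) g x) (hX : DiffFieldAt X x) (hZ : DiffFieldAt Z x)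
    (v : TangentSpace (𝓡 n) x) :
    mvfderiv (𝓡 n) (fun y ↦ γ y (X y) ((g • Z) y)) x v =
      g x * mvfderiv (𝓡 n) (fun y ↦ γ y (X y) (Z y)) x v
        + mvfderiv (𝓡 n) g x v * γ x (X x) (Z x) := by
  simp only [Pi.smul_apply', map_smul, smul_eq_mul]
  rw [mvfderiv_fun_mul hg (hγ.mdifferentiableAt_apply₂ hX hZ)]
  simp only [add_apply, smul_apply, smul_eq_mul]
  ring

theorem mvfderiv_tensor_add_left (hγ : SmoothTensorAt γ x)
    (hX : DiffFieldAt X x) (hX' : DiffFieldAt X' x) (hZ : DiffFieldAt Z x)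
    (v : TangentSpace (𝓡 n) x) :
    mvfderiv (𝓡 n) (fun y ↦ γ y ((X + X') y) (Z y)) x v =
      mvfderiv (𝓡 n) (fun y ↦ γ y (X y) (Z y)) x v
        + mvfderiv (𝓡 n) (fun y ↦ γ y (X' y) (Z y)) x v := by
  simp only [Pi.add_apply, map_add, add_apply]
  rw [mvfderiv_fun_add (hγ.mdifferentiableAt_apply₂ hX hZ) (hγ.mdifferentiableAt_apply₂ hX' hZ)]
  rfl

theorem mvfderiv_tensor_add_right (hγ : SmoothTensorAt γ x)
    (hX : DiffFieldAt X x) (hZ : DiffFieldAt Z x) (hZ' : DiffFieldAt Z' x)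
    (v : TangentSpace (𝓡 n) x) :
    mvfderiv (𝓡 n) (fun y ↦ γ y (X y) ((Z + Z') y)) x v =
      mvfderiv (𝓡 n) (fun y ↦ γ y (X y) (Z y)) x v
        + mvfderiv (𝓡 n) (fun y ↦ γ y (X y) (Z' y)) x v := by
  simp only [Pi.add_apply, map_add]
  rw [mvfderiv_fun_add (hγ.mdifferentiableAt_apply₂ hX hZ) (hγ.mdifferentiableAt_apply₂ hX hZ')]
  rfl

theorem koszul_smul_left (hγ : SmoothTensorAt γ x)
    (hg : MDifferentiableAt (𝓡 n) 𝓘(ℝ, ℝ) g x)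
    (hX : DiffFieldAt X x) (hZ : DiffFieldAt Z x) (hW : DiffFieldAt W x) :
    koszul γ (g • X) Z W x = g x * koszul γ X Z W x := by
  rw [koszul, koszul, mvfderiv_tensor_smul_left hγ hg hX hW, mvfderiv_tensor_smul_left hγ hg hX hZ,
    mlieBracket_smul_left hg hX, mlieBracket_smul_left hg hX]
  simp only [Pi.smul_apply', map_smul, smul_eq_mul, smul_apply, map_add, map_neg, neg_apply, add_apply,
    neg_smul]
  ring

theorem koszul_smul_right (hγ : SmoothTensorAt γ x) (hs : ∀ v w, γ x v w = γ x w v)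
    (hg : MDifferentiableAt (𝓡 n) 𝓘(ℝ, ℝ) g x)
    (hX : DiffFieldAt X x) (hZ : DiffFieldAt Z x) (hW : DiffFieldAt W x) :
    koszul γ X Z (g • W) x = g x * koszul γ X Z W x := by
  rw [koszul, koszul, mvfderiv_tensor_smul_right hγ hg hX hW, mvfderiv_tensor_smul_right hγ hg hZ hW,
    mlieBracket_smul_right hg hW, mlieBracket_smul_right hg hW]
  simp only [Pi.smul_apply', map_smul, smul_eq_mul, smul_apply, map_add, add_apply]
  rw [hs (W x), hs (W x)]
  ring

theorem koszul_smul_mid (hγ : SmoothTensorAt γ x) (hs : ∀ v w, γ x v w = γ x w v)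
    (hg : MDifferentiableAt (𝓡 n) 𝓘(ℝ, ℝ) g x)
    (hX : DiffFieldAt X x) (hZ : DiffFieldAt Z x) (hW : DiffFieldAt W x) :
    koszul γ X (g • Z) W x = g x * koszul γ X Z W x + mvfderiv (𝓡 n) g x (X x) * γ x (Z x) (W x) := by
  rw [koszul, koszul, mvfderiv_tensor_smul_left hγ hg hZ hW, mvfderiv_tensor_smul_right hγ hg hX hZ,
    mlieBracket_smul_right hg hZ, mlieBracket_smul_left hg hZ]
  simp only [Pi.smul_apply', map_smul, smul_eq_mul, smul_apply, map_add, add_apply, map_neg, neg_apply,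
    neg_smul]
  rw [hs (Z x) (X x)]
  ring

theorem koszul_add_left (hγ : SmoothTensorAt γ x)
    (hX : DiffFieldAt X x) (hX' : DiffFieldAt X' x) (hZ : DiffFieldAt Z x) (hW : DiffFieldAt W x) :
    koszul γ (X + X') Z W x = koszul γ X Z W x + koszul γ X' Z W x := by
  rw [koszul, koszul, koszul, mvfderiv_tensor_add_left hγ hX hX' hW,
    mvfderiv_tensor_add_left hγ hX hX' hZ, mlieBracket_add_left hX hX', mlieBracket_add_left hX hX']
  simp only [Pi.add_apply, map_add, add_apply]
  ring

theorem koszul_add_right (hγ : SmoothTensorAt γ x)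
    (hX : DiffFieldAt X x) (hZ : DiffFieldAt Z x) (hW : DiffFieldAt W x) (hW' : DiffFieldAt W' x) :
    koszul γ X Z (W + W') x = koszul γ X Z W x + koszul γ X Z W' x := by
  rw [koszul, koszul, koszul, mvfderiv_tensor_add_right hγ hZ hW hW',
    mvfderiv_tensor_add_right hγ hX hW hW', mlieBracket_add_right hW hW', mlieBracket_add_right hW hW']
  simp only [Pi.add_apply, map_add, add_apply]
  ring

theorem koszul_add_mid (hγ : SmoothTensorAt γ x)
    (hX : DiffFieldAt X x) (hZ : DiffFieldAt Z x) (hZ' : DiffFieldAt Z' x) (hW : DiffFieldAt W x) :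
    koszul γ X (Z + Z') W x = koszul γ X Z W x + koszul γ X Z' W x := by
  rw [koszul, koszul, koszul, mvfderiv_tensor_add_left hγ hZ hZ' hW,
    mvfderiv_tensor_add_right hγ hX hZ hZ', mlieBracket_add_right hZ hZ', mlieBracket_add_left hZ hZ']
  simp only [Pi.add_apply, map_add, add_apply]
  ring

theorem koszulCovector_smul_left (hℓ : SmoothCovectorAt ℓ x)
    (hg : MDifferentiableAt (𝓡 n) 𝓘(ℝ, ℝ) g x) (hX : DiffFieldAt X x) :
    koszulCovector ℓ (g • X) Z x = g x * koszulCovector ℓ X Z x := by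
  rw [koszulCovector, koszulCovector, mvfderiv_covector_smul hℓ hg hX, mlieBracket_smul_left hg hX]
  simp only [Pi.smul_apply', map_smul, smul_eq_mul, map_add, map_neg, neg_smul]
  ring

theorem koszulCovector_smul_right (hℓ : SmoothCovectorAt ℓ x)
    (hg : MDifferentiableAt (𝓡 n) 𝓘(ℝ, ℝ) g x) (hZ : DiffFieldAt Z x) :
    koszulCovector ℓ X (g • Z) x =
      g x * koszulCovector ℓ X Z x + mvfderiv (𝓡 n) g x (X x) * ℓ x (Z x) := by
  rw [koszulCovector, koszulCovector, mvfderiv_covector_smul hℓ hg hZ, mlieBracket_smul_right hg hZ]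
  simp only [Pi.smul_apply', map_smul, smul_eq_mul, map_add]
  ring

theorem koszulCovector_add_left (hℓ : SmoothCovectorAt ℓ x)
    (hX : DiffFieldAt X x) (hX' : DiffFieldAt X' x) :
    koszulCovector ℓ (X + X') Z x = koszulCovector ℓ X Z x + koszulCovector ℓ X' Z x := by
  rw [koszulCovector, koszulCovector, koszulCovector, mvfderiv_covector_add hℓ hX hX',
    mlieBracket_add_left hX hX']
  simp only [Pi.add_apply, map_add]
  ring

theorem koszulCovector_add_right (hℓ : SmoothCovectorAt ℓ x)
    (hZ : DiffFieldAt Z x) (hZ' : DiffFieldAt Z' x) :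
    koszulCovector ℓ X (Z + Z') x = koszulCovector ℓ X Z x + koszulCovector ℓ X Z' x := by
  rw [koszulCovector, koszulCovector, koszulCovector, mvfderiv_covector_add hℓ hZ hZ',
    mlieBracket_add_right hZ hZ']
  simp only [Pi.add_apply, map_add]
  ring

theorem lieDerivative_smul_left (hγ : SmoothTensorAt γ x)
    (hg : MDifferentiableAt (𝓡 n) 𝓘(ℝ, ℝ) g x) (hX : DiffFieldAt X x) (hZ : DiffFieldAt Z x) :
    lieDerivative V γ (g • X) Z x = g x * lieDerivative V γ X Z x := by
  rw [lieDerivative, lieDerivative, mvfderiv_tensor_smul_left hγ hg hX hZ,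
    mlieBracket_smul_right hg hX]
  simp only [Pi.smul_apply', map_smul, smul_eq_mul, smul_apply, map_add, add_apply]
  ring

theorem lieDerivative_smul_right (hγ : SmoothTensorAt γ x)
    (hg : MDifferentiableAt (𝓡 n) 𝓘(ℝ, ℝ) g x) (hX : DiffFieldAt X x) (hZ : DiffFieldAt Z x) :
    lieDerivative V γ X (g • Z) x = g x * lieDerivative V γ X Z x := by
  rw [lieDerivative, lieDerivative, mvfderiv_tensor_smul_right hγ hg hX hZ,
    mlieBracket_smul_right hg hZ]
  simp only [Pi.smul_apply', map_smul, smul_eq_mul, map_add]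
  ring

theorem lieDerivative_add_left (hγ : SmoothTensorAt γ x)
    (hX : DiffFieldAt X x) (hX' : DiffFieldAt X' x) (hZ : DiffFieldAt Z x) :
    lieDerivative V γ (X + X') Z x = lieDerivative V γ X Z x + lieDerivative V γ X' Z x := by
  rw [lieDerivative, lieDerivative, lieDerivative, mvfderiv_tensor_add_left hγ hX hX' hZ,
    mlieBracket_add_right hX hX']
  simp only [Pi.add_apply, map_add, add_apply]
  ring

theorem lieDerivative_add_right (hγ : SmoothTensorAt γ x)
    (hX : DiffFieldAt X x) (hZ : DiffFieldAt Z x) (hZ' : DiffFieldAt Z' x) :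
    lieDerivative V γ X (Z + Z') x = lieDerivative V γ X Z x + lieDerivative V γ X Z' x := by
  rw [lieDerivative, lieDerivative, lieDerivative, mvfderiv_tensor_add_right hγ hX hZ hZ',
    mlieBracket_add_right hZ hZ']
  simp only [Pi.add_apply, map_add]
  ring

/-- The value that the Koszul equations prescribe for `(γ + ℓ ⊗ ℓ)(∇_X Z, W)` at `x`. The argument
`Z` comes first, as the expression is tensorial in `X` and `W` and a derivation in `Z`. -/
def connectionForm (γ : TensorField n N) (ℓ : CovectorField n N) (ℓ₂ : N → ℝ) (x : N)
    (Z X W : VField n N) : ℝ :=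
  koszul γ X Z W x
    + (tensorU γ ℓ X Z x + koszulCovector ℓ X Z x + ℓ₂ x * tensorU γ ℓ X Z x) * ℓ x (W x)

theorem connectionForm_tensorialAt_left (hγ : SmoothTensorAt γ x)
    (hℓ : SmoothCovectorAt ℓ x) (hZ : DiffFieldAt Z x) (hW : DiffFieldAt W x) :
    TensorialAt (𝓡 n) (EuclideanSpace ℝ (Fin n)) (connectionForm γ ℓ ℓ₂ x Z · W) x where
  smul hg hX := by
    simp only [connectionForm, tensorU, koszul_smul_left hγ hg hX hZ hW,
      koszulCovector_smul_left hℓ hg hX, lieDerivative_smul_left hγ hg hX hZ, smul_eq_mul]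
    ring
  add hX hX' := by
    simp only [connectionForm, tensorU, koszul_add_left hγ hX hX' hZ hW,
      koszulCovector_add_left hℓ hX hX', lieDerivative_add_left hγ hX hX' hZ]
    ring

theorem connectionForm_tensorialAt_right (hγ : SmoothTensorAt γ x) (hs : ∀ v w, γ x v w = γ x w v)
    (hX : DiffFieldAt X x) (hZ : DiffFieldAt Z x) :
    TensorialAt (𝓡 n) (EuclideanSpace ℝ (Fin n)) (connectionForm γ ℓ ℓ₂ x Z X) x where
  smul hg hW := by
    simp only [connectionForm, koszul_smul_right hγ hs hg hX hZ hW, smul_eq_mul, Pi.smul_apply',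
      map_smul]
    ring
  add hW hW' := by
    simp only [connectionForm, koszul_add_right hγ hX hZ hW hW', Pi.add_apply, map_add]
    ring

theorem connectionForm_add (hγ : SmoothTensorAt γ x) (hℓ : SmoothCovectorAt ℓ x)
    (hX : DiffFieldAt X x) (hZ : DiffFieldAt Z x) (hZ' : DiffFieldAt Z' x) (hW : DiffFieldAt W x) :
    connectionForm γ ℓ ℓ₂ x (Z + Z') X W =
      connectionForm γ ℓ ℓ₂ x Z X W + connectionForm γ ℓ ℓ₂ x Z' X W := by
  simp only [connectionForm, tensorU, koszul_add_mid hγ hX hZ hZ' hW,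
    koszulCovector_add_right hℓ hZ hZ', lieDerivative_add_right hγ hX hZ hZ']
  ring

theorem connectionForm_smul (hγ : SmoothTensorAt γ x) (hs : ∀ v w, γ x v w = γ x w v)
    (hℓ : SmoothCovectorAt ℓ x) (hg : MDifferentiableAt (𝓡 n) 𝓘(ℝ, ℝ) g x)
    (hX : DiffFieldAt X x) (hZ : DiffFieldAt Z x) (hW : DiffFieldAt W x) :
    connectionForm γ ℓ ℓ₂ x (g • Z) X W = g x * connectionForm γ ℓ ℓ₂ x Z X W +
      mvfderiv (𝓡 n) g x (X x) * completedForm γ ℓ x (Z x) (W x) := by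
  simp only [connectionForm, tensorU, koszul_smul_mid hγ hs hg hX hZ hW, completedForm_apply,
    koszulCovector_smul_right hℓ hg hZ, lieDerivative_smul_right hγ hg hX hZ]
  ring

end Tensoriality

/-! ### Existence of the metric hypersurface connection -/

section Existence

variable {n : ℕ} {N : Type u} [TopologicalSpace N]
  [ChartedSpace (EuclideanSpace ℝ (Fin n)) N] [IsManifold (𝓡 n) ∞ N]
  {U : Set N} {x : N} {γ : TensorField n N} {ℓ ℓ' : CovectorField n N} {ℓ₂ ℓ₂' : N → ℝ}
  {X Z W : VField n N}

/-- The covector field `ℓ` is smooth at `x`, as is `γ`, and transverse to the radical near `x`. Unlike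
`IsNullDataOn` this does not refer to a domain of the data. -/
structure RegularDataAt (γ : TensorField n N) (ℓ : CovectorField n N) (x : N) : Prop where
  smooth_tensor : SmoothTensorAt γ x
  smooth_covector : SmoothCovectorAt ℓ x
  transverse : ∀ᶠ y in 𝓝 x, TransverseAt γ ℓ y

theorem IsNullDataOn.regularDataAt (h : IsNullDataOn γ ℓ ℓ₂ U) (hU : IsOpen U) (hx : x ∈ U) :
    RegularDataAt γ ℓ x where
  smooth_tensor := h.null.smooth.smoothTensorAt (hU.mem_nhds hx)
  smooth_covector := h.smooth_covector.smoothCovectorAt (hU.mem_nhds hx)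
  transverse := by
    filter_upwards [hU.mem_nhds hx] with y hy
    exact h.transverseAt hy

namespace RegularDataAt

theorem smoothFieldAt_nullVector (h : RegularDataAt γ ℓ x) : SmoothFieldAt (nullVector γ ℓ) x :=
  NullGeometry.smoothFieldAt_nullVector h.smooth_tensor h.smooth_covector h.transverse

theorem symm (h : RegularDataAt γ ℓ x) : ∀ᶠ y in 𝓝 x, ∀ v w, γ y v w = γ y w v :=
  h.transverse.mono fun _ hy ↦ hy.symm

/-- As `γ(n, ·) = 0`, Koszul's expression with `n` in the last slot is `-U(X, Z)`. This is the
compatibility condition between the two Koszul equations: the left-hand side of the first vanishes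
at `W = n`. -/
theorem koszul_nullVector (h : RegularDataAt γ ℓ x) :
    koszul γ X Z (nullVector γ ℓ) x = - tensorU γ ℓ X Z x := by
  have h0 (X : VField n N) :
      mvfderiv (𝓡 n) (fun y ↦ γ y (X y) (nullVector γ ℓ y)) x = 0 := by
    have : (fun y ↦ γ y (X y) (nullVector γ ℓ y)) =ᶠ[𝓝 x] fun _ ↦ 0 := by
      filter_upwards [h.transverse] with y hy
      rw [hy.symm, hy.nullVector_spec.1, zero_apply]
    exact this.mfderiv_eq.trans (mvfderiv_const (0 : ℝ))
  have hbr (X : VField n N) : mlieBracket (𝓡 n) X (nullVector γ ℓ) x =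
      - mlieBracket (𝓡 n) (nullVector γ ℓ) X x := mlieBracket_swap_apply
  have ht := h.transverse.self_of_nhds
  rw [koszul, tensorU, lieDerivative, h0, h0, hbr, hbr,
    ht.symm (mlieBracket (𝓡 n) X Z x), ht.nullVector_spec.1, ht.symm (X x)]
  simp only [zero_apply, map_neg, neg_apply]
  ring

end RegularDataAt

open Classical in
/-- The operator `∇` with `(γ + ℓ ⊗ ℓ)(∇_X Z, ·) = connectionForm γ ℓ ℓ₂ x Z X` at `x`. Where the
data are not regular or `Z` is not differentiable, the value is `0`. -/
def koszulConnection (γ : TensorField n N) (ℓ : CovectorField n N) (ℓ₂ : N → ℝ) :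
    RawConnection n N := fun Z x ↦
  if h : RegularDataAt γ ℓ x ∧ DiffFieldAt Z x then
    (completedForm γ ℓ x).inverse.comp
      (TensorialAt.mkHom₂ (connectionForm γ ℓ ℓ₂ x Z) x
        (fun _ hW ↦ connectionForm_tensorialAt_left h.1.smooth_tensor
          h.1.smooth_covector h.2 hW)
        (fun _ hX ↦ connectionForm_tensorialAt_right h.1.smooth_tensor
          h.1.transverse.self_of_nhds.symm hX h.2))
  else 0

theorem completedForm_koszulConnection (h : RegularDataAt γ ℓ x) (hX : DiffFieldAt X x)
    (hZ : DiffFieldAt Z x) (hW : DiffFieldAt W x) :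
    completedForm γ ℓ x (koszulConnection γ ℓ ℓ₂ Z x (X x)) (W x) =
      connectionForm γ ℓ ℓ₂ x Z X W := by
  obtain ⟨e, he⟩ := h.transverse.self_of_nhds.isInvertible
  rw [koszulConnection, dif_pos ⟨h, hZ⟩, ContinuousLinearMap.comp_apply, ← he,
    ContinuousLinearMap.inverse_equiv, ContinuousLinearEquiv.coe_coe, ContinuousLinearEquiv.coe_coe,
    ContinuousLinearEquiv.apply_symm_apply]
  exact TensorialAt.mkHom₂_apply _ _ hX hW

theorem TransverseAt.eq_of_completedForm (h : TransverseAt γ ℓ x) {v w : TangentSpace (𝓡 n) x}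
    (hvw : ∀ W : VField n N, DiffFieldAt W x →
      completedForm γ ℓ x v (W x) = completedForm γ ℓ x w (W x)) : v = w := by
  obtain ⟨e, he⟩ := h.isInvertible
  apply e.injective
  ext u
  obtain ⟨W, hW, rfl⟩ := exists_smooth_extension u
  rw [← ContinuousLinearEquiv.coe_coe, he]
  exact hvw W hW.self_of_nhds.diffFieldAt

theorem isCovariantDerivativeOn_koszulConnection (h : ∀ x ∈ U, RegularDataAt γ ℓ x) :
    IsCovariantDerivativeOn (I := 𝓡 n) (EuclideanSpace ℝ (Fin n)) (koszulConnection γ ℓ ℓ₂) U where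
  add {Z Z' x} hZ hZ' hx := by
    have hr := h x hx
    ext v
    obtain ⟨X, hX, rfl⟩ := exists_smooth_extension v
    replace hX := hX.self_of_nhds.diffFieldAt
    refine hr.transverse.self_of_nhds.eq_of_completedForm fun W hW ↦ ?_
    rw [add_apply, map_add, add_apply, completedForm_koszulConnection hr hX hZ hW,
      completedForm_koszulConnection hr hX hZ' hW,
      completedForm_koszulConnection hr hX (DiffFieldAt.add hZ hZ') hW,
      connectionForm_add hr.smooth_tensor hr.smooth_covector hX hZ hZ' hW]
  leibniz {Z g x} hZ hg hx := by
    have hr := h x hx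
    ext v
    obtain ⟨X, hX, rfl⟩ := exists_smooth_extension v
    replace hX := hX.self_of_nhds.diffFieldAt
    refine hr.transverse.self_of_nhds.eq_of_completedForm fun W hW ↦ ?_
    rw [completedForm_koszulConnection hr hX (DiffFieldAt.smul hg hZ) hW,
      connectionForm_smul hr.smooth_tensor hr.transverse.self_of_nhds.symm hr.smooth_covector
        hg hX hZ hW]
    simp only [add_apply, smul_apply, map_add, map_smul, smul_eq_mul,
      ContinuousLinearMap.smulRight_apply, completedForm_koszulConnection hr hX hZ hW]

theorem satisfiesKoszulAt_koszulConnection (h : RegularDataAt γ ℓ x) :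
    SatisfiesKoszulAt γ ℓ ℓ₂ x (fun Z ↦ koszulConnection γ ℓ ℓ₂ Z x) := by
  have ht := h.transverse.self_of_nhds
  have hell (X Z : VField n N) (hX : SmoothFieldAt X x) (hZ : SmoothFieldAt Z x) :
      ℓ x (koszulConnection γ ℓ ℓ₂ Z x (X x)) =
        koszulCovector ℓ X Z x + ℓ₂ x * tensorU γ ℓ X Z x := by
    have := completedForm_koszulConnection (ℓ₂ := ℓ₂) h hX.diffFieldAt hZ.diffFieldAt
      h.smoothFieldAt_nullVector.diffFieldAt
    rw [completedForm_apply, ht.symm, ht.nullVector_spec.1, ht.nullVector_spec.2, connectionForm,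
      h.koszul_nullVector, ht.nullVector_spec.2, zero_apply] at this
    linear_combination this
  refine ⟨fun X Z W hX hZ hW ↦ ?_, hell⟩
  have := completedForm_koszulConnection (ℓ₂ := ℓ₂) h hX.diffFieldAt hZ.diffFieldAt hW.diffFieldAt
  rw [completedForm_apply, connectionForm, hell X Z hX hZ] at this
  linear_combination this

theorem contMDiffAt_tensorU (h : RegularDataAt γ ℓ x) (hX : SmoothFieldAt X x)
    (hZ : SmoothFieldAt Z x) :
    ContMDiffAt (𝓡 n) 𝓘(ℝ, ℝ) ∞ (tensorU γ ℓ X Z) x := by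
  have hn := h.smoothFieldAt_nullVector
  have hγ := h.smooth_tensor
  exact contMDiffAt_const.mul (((contMDiffAt_mvfderiv_apply (hγ.apply₂ hX hZ) hn).sub
    (hγ.apply₂ (smoothFieldAt_mlieBracket hn hX) hZ)).sub
    (hγ.apply₂ hX (smoothFieldAt_mlieBracket hn hZ)))

theorem contMDiffAt_koszul (hγ : SmoothTensorAt γ x) (hX : SmoothFieldAt X x)
    (hZ : SmoothFieldAt Z x) (hW : SmoothFieldAt W x) :
    ContMDiffAt (𝓡 n) 𝓘(ℝ, ℝ) ∞ (koszul γ X Z W) x :=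
  contMDiffAt_const.mul ((((((contMDiffAt_mvfderiv_apply (hγ.apply₂ hZ hW) hX).add
    (contMDiffAt_mvfderiv_apply (hγ.apply₂ hX hW) hZ)).sub
    (contMDiffAt_mvfderiv_apply (hγ.apply₂ hX hZ) hW)).add
    (hγ.apply₂ (smoothFieldAt_mlieBracket hX hZ) hW)).sub
    (hγ.apply₂ (smoothFieldAt_mlieBracket hX hW) hZ)).sub
    (hγ.apply₂ (smoothFieldAt_mlieBracket hZ hW) hX))

theorem contMDiffAt_koszulCovector (hℓ : SmoothCovectorAt ℓ x) (hX : SmoothFieldAt X x)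
    (hZ : SmoothFieldAt Z x) :
    ContMDiffAt (𝓡 n) 𝓘(ℝ, ℝ) ∞ (koszulCovector ℓ X Z) x :=
  contMDiffAt_const.mul (((contMDiffAt_mvfderiv_apply (hℓ.apply hZ) hX).add
    (contMDiffAt_mvfderiv_apply (hℓ.apply hX) hZ)).add
    (hℓ.apply (smoothFieldAt_mlieBracket hX hZ)))

/-- On smooth fields the Koszul equations express `(γ + ℓ ⊗ ℓ)(∇_X Z, W)` through smooth functions. -/
theorem contMDiffCovariantDerivativeOn_of_satisfiesKoszulAt (hU : IsOpen U)
    (hd : IsNullDataOn γ ℓ ℓ₂ U) {cov : RawConnection n N}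
    (h : ∀ x ∈ U, SatisfiesKoszulAt γ ℓ ℓ₂ x (fun Z ↦ cov Z x)) :
    ContMDiffCovariantDerivativeOn (I := 𝓡 n) (EuclideanSpace ℝ (Fin n)) ∞ cov U where
  contMDiff {Z} hZ x hx := by
    have hr := hd.regularDataAt hU hx
    refine (contMDiffAt_hom_of_apply (E₁ := (TangentSpace (𝓡 n) : N → Type _))
      (E₂ := (TangentSpace (𝓡 n) : N → Type _)) (φ := cov Z) fun X hX ↦ ?_).contMDiffWithinAt
    have hG := hr.smooth_tensor.completedForm hr.smooth_covector
    refine hG.smoothFieldAt_of_apply (X := fun y ↦ cov Z y (X y))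
      hr.transverse.self_of_nhds.isInvertible (SmoothCovectorAt.of_apply fun W hW ↦ ?_)
    have hZ' : ∀ y ∈ U, SmoothFieldAt Z y := fun y hy ↦
      (hZ.contMDiffAt (hU.mem_nhds hy)).of_le (by simp)
    have hX' := hX.self_of_nhds
    have hW' := hW.self_of_nhds
    have hUs := contMDiffAt_tensorU hr hX' (hZ' x hx)
    refine (((contMDiffAt_koszul hr.smooth_tensor hX' (hZ' x hx) hW').add
      (hUs.mul (hr.smooth_covector.apply hW'))).add
      (((contMDiffAt_koszulCovector hr.smooth_covector hX' (hZ' x hx)).add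
        ((hd.smooth_scalar.contMDiffAt (hU.mem_nhds hx)).mul hUs)).mul
        (hr.smooth_covector.apply hW'))).congr_of_eventuallyEq ?_
    filter_upwards [hU.mem_nhds hx, hX, hW] with y hy hXy hWy
    rw [completedForm_apply, (h y hy).gamma X Z W hXy (hZ' y hy) hWy,
      (h y hy).ell X Z hXy (hZ' y hy)]
    rfl

/-- Metric hypersurface connections are the covariant derivatives that satisfy the Koszul equations.
Smoothness is automatic. -/
theorem isMetricHypersurfaceConnectionOn_iff (hU : IsOpen U)
    (hd : IsNullDataOn γ ℓ ℓ₂ U) {cov : RawConnection n N} :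
    IsMetricHypersurfaceConnectionOn γ ℓ ℓ₂ cov U ↔
      IsCovariantDerivativeOn (I := 𝓡 n) (EuclideanSpace ℝ (Fin n)) cov U ∧
        ∀ x ∈ U, SatisfiesKoszulAt γ ℓ ℓ₂ x (fun Z ↦ cov Z x) := by
  refine ⟨fun h ↦ ⟨h.isCov, fun x hx ↦ satisfiesKoszulAt_of_conditions
    (hd.regularDataAt hU hx).symm (h.torsionFree x hx) (h.cov_gamma x hx) (h.cov_ell x hx)⟩,
    fun ⟨hcov, h⟩ ↦ ?_⟩
  have hc (x) (hx : x ∈ U) := (h x hx).conditions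
    (hd.regularDataAt hU hx).transverse.self_of_nhds (hd.regularDataAt hU hx).symm
  exact ⟨hcov, contMDiffCovariantDerivativeOn_of_satisfiesKoszulAt hU hd h,
    fun x hx ↦ (hc x hx).1, fun x hx ↦ (hc x hx).2.1, fun x hx ↦ (hc x hx).2.2⟩

theorem exists_metricHypersurfaceConnection (hd : IsNullDataOn γ ℓ ℓ₂ Set.univ) :
    ∃ cov : Connection n N, IsMetricHypersurfaceConnectionOn γ ℓ ℓ₂ cov Set.univ := by
  have hr (x : N) := hd.regularDataAt isOpen_univ (Set.mem_univ x)
  have hcov := isCovariantDerivativeOn_koszulConnection (ℓ₂ := ℓ₂) (U := Set.univ) fun x _ ↦ hr x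
  exact ⟨⟨koszulConnection γ ℓ ℓ₂, hcov⟩, (isMetricHypersurfaceConnectionOn_iff isOpen_univ hd).2
    ⟨hcov, fun x _ ↦ satisfiesKoszulAt_koszulConnection (hr x)⟩⟩

/-! ### The gauge element that changes the sign of the covector -/

section Gauge

theorem SmoothCovectorAt.neg (h : SmoothCovectorAt ℓ x) : SmoothCovectorAt (-ℓ) x :=
  ContMDiffAt.neg_section h

theorem RegularDataAt.neg (h : RegularDataAt γ ℓ x) : RegularDataAt γ (-ℓ) x :=
  ⟨h.smooth_tensor, h.smooth_covector.neg, h.transverse.mono fun _ hy ↦ hy.neg⟩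

theorem RegularDataAt.tensorU_neg (h : RegularDataAt γ ℓ x) (X Z : VField n N) :
    tensorU γ (-ℓ) X Z x = - tensorU γ ℓ X Z x := by
  have hev : nullVector γ (-ℓ) =ᶠ[𝓝 x] (-1 : ℝ) • nullVector γ ℓ :=
    h.transverse.mono fun y hy ↦ by
      rw [hy.nullVector_neg, Pi.smul_apply]
      exact (neg_one_smul ℝ (M := TangentSpace (𝓡 n) y) _).symm
  have hbr (X : VField n N) : mlieBracket (𝓡 n) (nullVector γ (-ℓ)) X x =
      (-1 : ℝ) • mlieBracket (𝓡 n) (nullVector γ ℓ) X x :=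
    (hev.mlieBracket_vectorField_eq (EventuallyEq.refl _ X)).trans
      (mlieBracket_const_smul_left h.smoothFieldAt_nullVector.diffFieldAt)
  rw [tensorU, tensorU, lieDerivative, lieDerivative, hbr, hbr, hev.self_of_nhds]
  simp only [Pi.smul_apply, map_smul, smul_apply, smul_eq_mul]
  ring

omit [IsManifold (𝓡 n) ∞ N] in
theorem koszulCovector_neg (X Z : VField n N) :
    koszulCovector (-ℓ) X Z x = - koszulCovector ℓ X Z x := by
  simp only [koszulCovector, Pi.neg_apply, neg_apply, mvfderiv_fun_neg]
  ring

/-- Both `n` and `U` change sign together with `ℓ`, so in each term of the Koszul equations the signs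
cancel or factor out. -/
theorem SatisfiesKoszulAt.neg {D : VField n N → TangentSpace (𝓡 n) x →L[ℝ] TangentSpace (𝓡 n) x}
    (h : SatisfiesKoszulAt γ ℓ ℓ₂ x D) (hr : RegularDataAt γ ℓ x) :
    SatisfiesKoszulAt γ (-ℓ) ℓ₂ x D where
  gamma X Z W hX hZ hW := by
    rw [h.gamma X Z W hX hZ hW, hr.tensorU_neg, Pi.neg_apply, neg_apply]
    ring
  ell X Z hX hZ := by
    rw [Pi.neg_apply, neg_apply, h.ell X Z hX hZ, hr.tensorU_neg, koszulCovector_neg]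
    ring

theorem IsNullDataOn.neg (h : IsNullDataOn γ ℓ ℓ₂ U) : IsNullDataOn γ (-ℓ) ℓ₂ U :=
  .of_transverseAt h.null (ContMDiffOn.neg_section h.smooth_covector) h.smooth_scalar
    fun _ hx ↦ (h.transverseAt hx).neg

theorem isMetricHypersurfaceConnectionOn_neg_iff (hU : IsOpen U) (hd : IsNullDataOn γ ℓ ℓ₂ U)
    {cov : RawConnection n N} : IsMetricHypersurfaceConnectionOn γ ℓ ℓ₂ cov U ↔
      IsMetricHypersurfaceConnectionOn γ (-ℓ) ℓ₂ cov U := by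
  rw [isMetricHypersurfaceConnectionOn_iff hU hd, isMetricHypersurfaceConnectionOn_iff hU hd.neg]
  refine and_congr_right fun _ ↦ forall₂_congr fun x hx ↦ ⟨fun h ↦ ?_, fun h ↦ ?_⟩
  · exact h.neg (hd.regularDataAt hU hx)
  · simpa using h.neg (hd.neg.regularDataAt hU hx)

end Gauge

end Existence

/-! ### Locality of the Koszul equations -/

section Locality

variable {n : ℕ} {N : Type u} [TopologicalSpace N]
  [ChartedSpace (EuclideanSpace ℝ (Fin n)) N] [IsManifold (𝓡 n) ∞ N]
  {x : N} {γ : TensorField n N} {ℓ ℓ' : CovectorField n N} {ℓ₂ ℓ₂' : N → ℝ}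
  {X Z W : VField n N}

omit [IsManifold (𝓡 n) ∞ N] in
theorem nullVector_congr (h : ℓ x = ℓ' x) : nullVector γ ℓ x = nullVector γ ℓ' x := by
  rw [nullVector, nullVector, h]

omit [IsManifold (𝓡 n) ∞ N] in
theorem tensorU_congr (h : ∀ᶠ y in 𝓝 x, ℓ y = ℓ' y) : tensorU γ ℓ X Z x = tensorU γ ℓ' X Z x := by
  have hev : nullVector γ ℓ =ᶠ[𝓝 x] nullVector γ ℓ' := h.mono fun y hy ↦ nullVector_congr hy
  have hbr (X : VField n N) : mlieBracket (𝓡 n) (nullVector γ ℓ) X x =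
      mlieBracket (𝓡 n) (nullVector γ ℓ') X x :=
    hev.mlieBracket_vectorField_eq (EventuallyEq.refl _ X)
  rw [tensorU, tensorU, lieDerivative, lieDerivative, hbr, hbr, hev.self_of_nhds]

omit [IsManifold (𝓡 n) ∞ N] in
theorem koszulCovector_congr (h : ∀ᶠ y in 𝓝 x, ℓ y = ℓ' y) :
    koszulCovector ℓ X Z x = koszulCovector ℓ' X Z x := by
  have hd (X Z : VField n N) : mvfderiv (𝓡 n) (fun y ↦ ℓ y (Z y)) x (X x) =
      mvfderiv (𝓡 n) (fun y ↦ ℓ' y (Z y)) x (X x) := by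
    have : (fun y ↦ ℓ y (Z y)) =ᶠ[𝓝 x] (fun y ↦ ℓ' y (Z y)) := h.mono fun y hy ↦ by
      simp only [hy]
    exact congrArg (fun L : TangentSpace (𝓡 n) x →L[ℝ] ℝ ↦ L (X x)) this.mfderiv_eq
  rw [koszulCovector, koszulCovector, hd, hd, h.self_of_nhds]

theorem SatisfiesKoszulAt.congr {D : VField n N → TangentSpace (𝓡 n) x →L[ℝ] TangentSpace (𝓡 n) x}
    (h : SatisfiesKoszulAt γ ℓ ℓ₂ x D) (hℓ : ∀ᶠ y in 𝓝 x, ℓ y = ℓ' y) (hℓ₂ : ℓ₂ x = ℓ₂' x) :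
    SatisfiesKoszulAt γ ℓ' ℓ₂' x D where
  gamma X Z W hX hZ hW := by
    rw [h.gamma X Z W hX hZ hW, tensorU_congr hℓ, hℓ.self_of_nhds]
  ell X Z hX hZ := by
    rw [← hℓ.self_of_nhds, h.ell X Z hX hZ, tensorU_congr hℓ, koszulCovector_congr hℓ, hℓ₂]

omit [IsManifold (𝓡 n) ∞ N] in
theorem TransverseAt.congr (h : TransverseAt γ ℓ x) (hℓ : ℓ x = ℓ' x) : TransverseAt γ ℓ' x :=
  ⟨h.symm, hℓ ▸ h.exists_null, hℓ ▸ h.eq_zero⟩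

theorem RegularDataAt.congr (h : RegularDataAt γ ℓ x) (hℓ : ∀ᶠ y in 𝓝 x, ℓ y = ℓ' y) :
    RegularDataAt γ ℓ' x where
  smooth_tensor := h.smooth_tensor
  smooth_covector := ContMDiffAt.congr_of_eventuallyEq h.smooth_covector
    (hℓ.mono fun y hy ↦ by simp only [hy])
  transverse := by
    filter_upwards [h.transverse, hℓ] with y hy hy'
    exact hy.congr hy'

/-- Two smooth covector fields that agree up to a sign at each point near `x` agree up to a single
sign near `x`: the sign is the value of `ℓ'` on `n`, which is continuous. -/
theorem RegularDataAt.eventuallyEq_or_neg (h : RegularDataAt γ ℓ x) (h' : SmoothCovectorAt ℓ' x)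
    (hs : ∀ᶠ y in 𝓝 x, ℓ' y = ℓ y ∨ ℓ' y = -ℓ y) :
    (∀ᶠ y in 𝓝 x, ℓ y = ℓ' y) ∨ ∀ᶠ y in 𝓝 x, (-ℓ) y = ℓ' y := by
  have hc : ContinuousAt (fun y ↦ ℓ' y (nullVector γ ℓ y)) x :=
    (h'.apply h.smoothFieldAt_nullVector).continuousAt
  rcases hs.self_of_nhds with hx | hx
  · left
    have hx' : 0 < ℓ' x (nullVector γ ℓ x) := by
      rw [hx, h.transverse.self_of_nhds.nullVector_spec.2]
      exact one_pos
    filter_upwards [hs, h.transverse, hc.eventually_const_lt hx'] with y hy hty hpos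
    rcases hy with hy | hy
    · exact hy.symm
    · rw [hy, neg_apply, hty.nullVector_spec.2] at hpos
      norm_num at hpos
  · right
    have hx' : ℓ' x (nullVector γ ℓ x) < 0 := by
      rw [hx, neg_apply, h.transverse.self_of_nhds.nullVector_spec.2]
      norm_num
    filter_upwards [hs, h.transverse, hc.eventually_lt_const hx'] with y hy hty hneg
    rcases hy with hy | hy
    · rw [hy, hty.nullVector_spec.2] at hneg
      norm_num at hneg
    · exact hy.symm

/-- Covectors that agree up to a sign near `x` lead to the same Koszul equations at `x`. -/
theorem SatisfiesKoszulAt.of_eq_or_neg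
    {D : VField n N → TangentSpace (𝓡 n) x →L[ℝ] TangentSpace (𝓡 n) x}
    (h : SatisfiesKoszulAt γ ℓ ℓ₂ x D) (hr : RegularDataAt γ ℓ x) (h' : SmoothCovectorAt ℓ' x)
    (hs : ∀ᶠ y in 𝓝 x, ℓ' y = ℓ y ∨ ℓ' y = -ℓ y) : SatisfiesKoszulAt γ ℓ' ℓ₂ x D := by
  rcases hr.eventuallyEq_or_neg h' hs with he | he
  · exact h.congr he rfl
  · exact (h.neg hr).congr he rfl

end Locality

/-! ### Naturality under local diffeomorphisms -/

section Pullback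

variable {n : ℕ} {N : Type u} [TopologicalSpace N]
  [ChartedSpace (EuclideanSpace ℝ (Fin n)) N] [IsManifold (𝓡 n) ∞ N]
  {C : Type u} [TopologicalSpace C]
  [ChartedSpace (EuclideanSpace ℝ (Fin n)) C] [IsManifold (𝓡 n) ∞ C]
  {f : C → N} {q : C} {γ : TensorField n N} {ℓ : CovectorField n N}
  {X Z W : VField n N}

omit [IsManifold (𝓡 n) ∞ N] [IsManifold (𝓡 n) ∞ C] in
theorem isInvertible_mfderiv (hf : IsLocalDiffeomorphAt (𝓡 n) (𝓡 n) ∞ f q) :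
    (mfderiv (𝓡 n) (𝓡 n) f q).IsInvertible :=
  ⟨hf.mfderivToContinuousLinearEquiv (by simp), rfl⟩

/-- The pull-back `f^⋆ ℓ` of a covector field. -/
def pullbackCovector (f : C → N) (ℓ : CovectorField n N) : CovectorField n C :=
  fun q ↦ (ℓ (f q)).comp (mfderiv (𝓡 n) (𝓡 n) f q)

omit [IsManifold (𝓡 n) ∞ N] [IsManifold (𝓡 n) ∞ C] in
theorem mfderiv_mpullback (hf : IsLocalDiffeomorphAt (𝓡 n) (𝓡 n) ∞ f q) (X : VField n N) :
    mfderiv (𝓡 n) (𝓡 n) f q (mpullback (𝓡 n) (𝓡 n) f X q) = X (f q) :=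
  (isInvertible_mfderiv hf).self_apply_inverse _

omit [IsManifold (𝓡 n) ∞ N] [IsManifold (𝓡 n) ∞ C] in
theorem pullbackTensor_mpullback (hf : IsLocalDiffeomorphAt (𝓡 n) (𝓡 n) ∞ f q) (X Z : VField n N) :
    pullbackTensor f γ q (mpullback (𝓡 n) (𝓡 n) f X q) (mpullback (𝓡 n) (𝓡 n) f Z q) =
      γ (f q) (X (f q)) (Z (f q)) := by
  change γ (f q) (mfderiv (𝓡 n) (𝓡 n) f q _) (mfderiv (𝓡 n) (𝓡 n) f q _) = _
  rw [mfderiv_mpullback hf, mfderiv_mpullback hf]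

omit [IsManifold (𝓡 n) ∞ N] [IsManifold (𝓡 n) ∞ C] in
theorem pullbackCovector_mpullback (hf : IsLocalDiffeomorphAt (𝓡 n) (𝓡 n) ∞ f q) (X : VField n N) :
    pullbackCovector f ℓ q (mpullback (𝓡 n) (𝓡 n) f X q) = ℓ (f q) (X (f q)) := by
  change ℓ (f q) (mfderiv (𝓡 n) (𝓡 n) f q _) = _
  rw [mfderiv_mpullback hf]

omit [IsManifold (𝓡 n) ∞ N] [IsManifold (𝓡 n) ∞ C] in
theorem mvfderiv_comp_mpullback (hf : IsLocalDiffeomorphAt (𝓡 n) (𝓡 n) ∞ f q) {φ : N → ℝ}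
    (hφ : MDifferentiableAt (𝓡 n) 𝓘(ℝ, ℝ) φ (f q)) (X : VField n N) :
    mvfderiv (𝓡 n) (φ ∘ f) q (mpullback (𝓡 n) (𝓡 n) f X q) = mvfderiv (𝓡 n) φ (f q) (X (f q)) := by
  rw [mvfderiv_comp_apply q hφ (hf.mdifferentiableAt (by simp)), mfderiv_mpullback hf]

theorem SmoothFieldAt.mpullback (hX : SmoothFieldAt X (f q))
    (hf : IsLocalDiffeomorphAt (𝓡 n) (𝓡 n) ∞ f q) :
    SmoothFieldAt (mpullback (𝓡 n) (𝓡 n) f X) q := by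
  have hC : IsManifold (𝓡 n) (∞ + 1) C := by simpa
  have hN : IsManifold (𝓡 n) (∞ + 1) N := by simpa
  exact ContMDiffAt.mpullback_vectorField_preimage (n := ∞) (m := ∞) hX hf.contMDiffAt
    (isInvertible_mfderiv hf) (by simp)

theorem DiffFieldAt.mpullback (hX : DiffFieldAt X (f q))
    (hf : IsLocalDiffeomorphAt (𝓡 n) (𝓡 n) ∞ f q) :
    DiffFieldAt (mpullback (𝓡 n) (𝓡 n) f X) q :=
  MDifferentiableAt.mpullback_vectorField (n := ∞) hX hf.contMDiffAt
    (isInvertible_mfderiv hf) ENat.LEInfty.out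

theorem mlieBracket_mpullback (hf : IsLocalDiffeomorphAt (𝓡 n) (𝓡 n) ∞ f q)
    (hX : SmoothFieldAt X (f q)) (hZ : SmoothFieldAt Z (f q)) :
    mlieBracket (𝓡 n) (mpullback (𝓡 n) (𝓡 n) f X) (mpullback (𝓡 n) (𝓡 n) f Z) q =
      mpullback (𝓡 n) (𝓡 n) f (mlieBracket (𝓡 n) X Z) q :=
  (mpullback_mlieBracket (n := ∞) hX.diffFieldAt hZ.diffFieldAt hf.contMDiffAt
    (by rw [minSmoothness_of_isRCLikeNormedField]; exact ENat.LEInfty.out)).symm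

theorem koszul_mpullback (hf : IsLocalDiffeomorph (𝓡 n) (𝓡 n) ∞ f) (hγ : SmoothTensorAt γ (f q))
    (hX : SmoothFieldAt X (f q)) (hZ : SmoothFieldAt Z (f q)) (hW : SmoothFieldAt W (f q)) :
    koszul (pullbackTensor f γ) (mpullback (𝓡 n) (𝓡 n) f X) (mpullback (𝓡 n) (𝓡 n) f Z)
      (mpullback (𝓡 n) (𝓡 n) f W) q = koszul γ X Z W (f q) := by
  have hd (X Z W : VField n N) (hZ : SmoothFieldAt Z (f q)) (hW : SmoothFieldAt W (f q)) :
      mvfderiv (𝓡 n) (fun y ↦ pullbackTensor f γ y (mpullback (𝓡 n) (𝓡 n) f Z y)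
        (mpullback (𝓡 n) (𝓡 n) f W y)) q (mpullback (𝓡 n) (𝓡 n) f X q) =
      mvfderiv (𝓡 n) (fun y ↦ γ y (Z y) (W y)) (f q) (X (f q)) := by
    rw [← mvfderiv_comp_mpullback (hf q)
      (hγ.mdifferentiableAt_apply₂ hZ.diffFieldAt hW.diffFieldAt)]
    congr 2
    funext y
    exact pullbackTensor_mpullback (hf y) Z W
  rw [koszul, koszul, hd X Z W hZ hW, hd Z X W hX hW, hd W X Z hX hZ,
    mlieBracket_mpullback (hf q) hX hZ, mlieBracket_mpullback (hf q) hX hW,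
    mlieBracket_mpullback (hf q) hZ hW]
  simp only [pullbackTensor_mpullback (hf q)]

theorem koszulCovector_mpullback (hf : IsLocalDiffeomorph (𝓡 n) (𝓡 n) ∞ f)
    (hℓ : SmoothCovectorAt ℓ (f q)) (hX : SmoothFieldAt X (f q)) (hZ : SmoothFieldAt Z (f q)) :
    koszulCovector (pullbackCovector f ℓ) (mpullback (𝓡 n) (𝓡 n) f X)
      (mpullback (𝓡 n) (𝓡 n) f Z) q = koszulCovector ℓ X Z (f q) := by
  have hd (X Z : VField n N) (hZ : SmoothFieldAt Z (f q)) :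
      mvfderiv (𝓡 n) (fun y ↦ pullbackCovector f ℓ y (mpullback (𝓡 n) (𝓡 n) f Z y)) q
        (mpullback (𝓡 n) (𝓡 n) f X q) = mvfderiv (𝓡 n) (fun y ↦ ℓ y (Z y)) (f q) (X (f q)) := by
    rw [← mvfderiv_comp_mpullback (hf q) (hℓ.mdifferentiableAt_apply hZ.diffFieldAt)]
    congr 2
    funext y
    exact pullbackCovector_mpullback (hf y) Z
  rw [koszulCovector, koszulCovector, hd X Z hZ, hd Z X hX, mlieBracket_mpullback (hf q) hX hZ,
    pullbackCovector_mpullback (hf q)]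

omit [IsManifold (𝓡 n) ∞ N] [IsManifold (𝓡 n) ∞ C] in
theorem transverseAt_pullback_iff (hf : IsLocalDiffeomorphAt (𝓡 n) (𝓡 n) ∞ f q) :
    TransverseAt (pullbackTensor f γ) (pullbackCovector f ℓ) q ↔ TransverseAt γ ℓ (f q) := by
  obtain ⟨e, he⟩ := isInvertible_mfderiv hf
  have hγ (v w : TangentSpace (𝓡 n) q) : pullbackTensor f γ q v w = γ (f q) (e v) (e w) := by
    change γ (f q) (mfderiv (𝓡 n) (𝓡 n) f q v) (mfderiv (𝓡 n) (𝓡 n) f q w) = _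
    rw [← he]; rfl
  have hℓ (v : TangentSpace (𝓡 n) q) : pullbackCovector f ℓ q v = ℓ (f q) (e v) := by
    change ℓ (f q) (mfderiv (𝓡 n) (𝓡 n) f q v) = _
    rw [← he]; rfl
  have h0 (v : TangentSpace (𝓡 n) q) : pullbackTensor f γ q v = 0 ↔ γ (f q) (e v) = 0 := by
    refine ⟨fun h ↦ ContinuousLinearMap.ext fun w ↦ ?_, fun h ↦ ContinuousLinearMap.ext fun w ↦ ?_⟩
    · rw [← e.apply_symm_apply w, ← hγ, h, zero_apply, zero_apply]
    · rw [hγ, h, zero_apply, zero_apply]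
  refine ⟨fun h ↦ ⟨fun v w ↦ ?_, ?_, fun v h₁ h₂ ↦ ?_⟩, fun h ↦ ⟨fun v w ↦ ?_, ?_, fun v h₁ h₂ ↦ ?_⟩⟩
  · rw [← e.apply_symm_apply v, ← e.apply_symm_apply w, ← hγ, h.symm, hγ]
  · obtain ⟨v, h₁, h₂⟩ := h.exists_null
    exact ⟨e v, (h0 v).1 h₁, (hℓ v).symm.trans h₂⟩
  · rw [← e.apply_symm_apply v, h.eq_zero (e.symm v) ((h0 _).2 (by rwa [e.apply_symm_apply]))
      (by rwa [hℓ, e.apply_symm_apply]), map_zero]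
  · rw [hγ, hγ, h.symm]
  · obtain ⟨v, h₁, h₂⟩ := h.exists_null
    exact ⟨e.symm v, (h0 _).2 (by rwa [e.apply_symm_apply]), by rwa [hℓ, e.apply_symm_apply]⟩
  · exact e.injective ((h.eq_zero _ ((h0 v).1 h₁) ((hℓ v).symm.trans h₂)).trans (map_zero e).symm)

omit [IsManifold (𝓡 n) ∞ N] [IsManifold (𝓡 n) ∞ C] in
theorem nullVector_pullback (hf : IsLocalDiffeomorphAt (𝓡 n) (𝓡 n) ∞ f q)
    (h : TransverseAt γ ℓ (f q)) : nullVector (pullbackTensor f γ) (pullbackCovector f ℓ) q =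
      mpullback (𝓡 n) (𝓡 n) f (nullVector γ ℓ) q := by
  refine ((transverseAt_pullback_iff hf).2 h).eq_nullVector (ContinuousLinearMap.ext fun w ↦ ?_) ?_
  · change γ (f q) (mfderiv (𝓡 n) (𝓡 n) f q _) (mfderiv (𝓡 n) (𝓡 n) f q w) = _
    rw [mfderiv_mpullback hf, h.nullVector_spec.1, zero_apply, zero_apply]
  · rw [pullbackCovector_mpullback hf, h.nullVector_spec.2]

theorem tensorU_mpullback (hf : IsLocalDiffeomorph (𝓡 n) (𝓡 n) ∞ f) (h : RegularDataAt γ ℓ (f q))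
    (hX : SmoothFieldAt X (f q)) (hZ : SmoothFieldAt Z (f q)) :
    tensorU (pullbackTensor f γ) (pullbackCovector f ℓ) (mpullback (𝓡 n) (𝓡 n) f X)
      (mpullback (𝓡 n) (𝓡 n) f Z) q = tensorU γ ℓ X Z (f q) := by
  have hν := h.smoothFieldAt_nullVector
  have hev : nullVector (pullbackTensor f γ) (pullbackCovector f ℓ) =ᶠ[𝓝 q]
      mpullback (𝓡 n) (𝓡 n) f (nullVector γ ℓ) := by
    filter_upwards [(hf q).contMDiffAt.continuousAt.eventually h.transverse] with y hy
    exact nullVector_pullback (hf y) hy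
  have hbr (X : VField n N) (hX : SmoothFieldAt X (f q)) :
      mlieBracket (𝓡 n) (nullVector (pullbackTensor f γ) (pullbackCovector f ℓ))
        (mpullback (𝓡 n) (𝓡 n) f X) q =
      mpullback (𝓡 n) (𝓡 n) f (mlieBracket (𝓡 n) (nullVector γ ℓ) X) q :=
    (hev.mlieBracket_vectorField_eq (EventuallyEq.refl _ _)).trans
      (mlieBracket_mpullback (hf q) hν hX)
  have hd : mvfderiv (𝓡 n) (fun y ↦ pullbackTensor f γ y (mpullback (𝓡 n) (𝓡 n) f X y)
        (mpullback (𝓡 n) (𝓡 n) f Z y)) q (mpullback (𝓡 n) (𝓡 n) f (nullVector γ ℓ) q) =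
      mvfderiv (𝓡 n) (fun y ↦ γ y (X y) (Z y)) (f q) (nullVector γ ℓ (f q)) := by
    rw [← mvfderiv_comp_mpullback (hf q)
      (h.smooth_tensor.mdifferentiableAt_apply₂ hX.diffFieldAt hZ.diffFieldAt)]
    congr 2
    funext y
    exact pullbackTensor_mpullback (hf y) X Z
  rw [tensorU, tensorU, lieDerivative, lieDerivative, hbr X hX, hbr Z hZ, hev.self_of_nhds, hd]
  simp only [pullbackTensor_mpullback (hf q)]

/-- Connections related by a local diffeomorphism: Koszul's equations pass from the source to the
target. -/
theorem SatisfiesKoszulAt.of_pullback (hf : IsLocalDiffeomorph (𝓡 n) (𝓡 n) ∞ f)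
    (hr : RegularDataAt γ ℓ (f q)) {ℓC : CovectorField n C} {ℓ₂C : C → ℝ} {ℓ₂ : N → ℝ}
    (hℓ : ∀ᶠ y in 𝓝 q, ℓC y = pullbackCovector f ℓ y) (hℓ₂ : ℓ₂C q = ℓ₂ (f q))
    {DC : VField n C → TangentSpace (𝓡 n) q →L[ℝ] TangentSpace (𝓡 n) q}
    {D : VField n N → TangentSpace (𝓡 n) (f q) →L[ℝ] TangentSpace (𝓡 n) (f q)}
    (hD : ∀ Z : VField n N, SmoothFieldAt Z (f q) → ∀ v, mfderiv (𝓡 n) (𝓡 n) f q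
      (DC (mpullback (𝓡 n) (𝓡 n) f Z) v) = D Z (mfderiv (𝓡 n) (𝓡 n) f q v))
    (h : SatisfiesKoszulAt (pullbackTensor f γ) ℓC ℓ₂C q DC) :
    SatisfiesKoszulAt γ ℓ ℓ₂ (f q) D := by
  replace h := h.congr (ℓ₂' := ℓ₂ ∘ f) hℓ hℓ₂
  have hD' (X Z : VField n N) (hZ : SmoothFieldAt Z (f q)) : D Z (X (f q)) =
      mfderiv (𝓡 n) (𝓡 n) f q (DC (mpullback (𝓡 n) (𝓡 n) f Z) (mpullback (𝓡 n) (𝓡 n) f X q)) := by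
    rw [hD Z hZ, mfderiv_mpullback (hf q)]
  refine ⟨fun X Z W hX hZ hW ↦ ?_, fun X Z hX hZ ↦ ?_⟩
  · have := h.gamma _ _ _ (hX.mpullback (hf q)) (hZ.mpullback (hf q)) (hW.mpullback (hf q))
    rw [koszul_mpullback hf hr.smooth_tensor hX hZ hW, tensorU_mpullback hf hr hX hZ,
      pullbackCovector_mpullback (hf q)] at this
    rw [← this, hD' X Z hZ]
    conv_lhs => rw [← mfderiv_mpullback (hf q) W]
    rfl
  · have := h.ell _ _ (hX.mpullback (hf q)) (hZ.mpullback (hf q))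
    rw [koszulCovector_mpullback hf hr.smooth_covector hX hZ, tensorU_mpullback hf hr hX hZ] at this
    rw [hD' X Z hZ]
    exact this

end Pullback

/-! ### Local existence of null metric hypersurface data -/

section LocalData

variable {n : ℕ} {N : Type u} [TopologicalSpace N]
  [ChartedSpace (EuclideanSpace ℝ (Fin n)) N] [IsManifold (𝓡 n) ∞ N]
  {U : Set N} {x : N} {γ : TensorField n N} {ℓ : CovectorField n N} {ℓ₂ : N → ℝ}

theorem exists_smooth_covector_ne_zero {v : TangentSpace (𝓡 n) x} (hv : v ≠ 0) :
    ∃ ℓ : CovectorField n N, (∀ᶠ y in 𝓝 x, SmoothCovectorAt ℓ y) ∧ ℓ x v ≠ 0 := by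
  have hinv : (mfderiv (𝓡 n) 𝓘(ℝ, EuclideanSpace ℝ (Fin n)) (extChartAt (𝓡 n) x) x).IsInvertible :=
    isInvertible_mfderiv_extChartAt (mem_extChartAt_source x)
  obtain ⟨w, hw⟩ : ∃ w : EuclideanSpace ℝ (Fin n),
      w = mfderiv (𝓡 n) 𝓘(ℝ, EuclideanSpace ℝ (Fin n)) (extChartAt (𝓡 n) x) x v := ⟨_, rfl⟩
  have hw0 : w ≠ 0 := hw ▸ fun h ↦ hv (hinv.injective (h.trans (map_zero _).symm))
  obtain ⟨α, hα⟩ := SeparatingDual.exists_ne_zero (R := ℝ) hw0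
  -- the differential of a linear function of the coordinates
  have hφ {y : N} (hy : y ∈ (chartAt (EuclideanSpace ℝ (Fin n)) x).source) :
      ContMDiffAt (𝓡 n) 𝓘(ℝ, ℝ) ∞ (α ∘ extChartAt (𝓡 n) x) y :=
    α.contMDiff.contMDiffAt.comp y (contMDiffAt_extChartAt' hy)
  refine ⟨mvfderiv (𝓡 n) (α ∘ extChartAt (𝓡 n) x), ?_, ?_⟩
  · filter_upwards [(chartAt (EuclideanSpace ℝ (Fin n)) x).open_source.mem_nhds
      (mem_chart_source _ x)] with y hy
    exact SmoothCovectorAt.of_apply fun X hX ↦ contMDiffAt_mvfderiv_apply (hφ hy) hX.self_of_nhds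
  · rw [mvfderiv_comp_apply x (α.contMDiff (n := 1) |>.mdifferentiable one_ne_zero _)
      ((contMDiffAt_extChartAt (n := 1)).mdifferentiableAt one_ne_zero)]
    have h1 : mvfderiv 𝓘(ℝ, EuclideanSpace ℝ (Fin n)) α (extChartAt (𝓡 n) x x) = α :=
      ContinuousLinearMap.mfderiv_eq α
    rw [h1, ← hw]
    exact hα

omit [IsManifold (𝓡 n) ∞ N] in
theorem transverseAt_of_isInvertible (hsymm : ∀ v w, γ x v w = γ x w v)
    (hrad : Module.finrank ℝ (radical γ x) = 1) (h : (completedForm γ ℓ x).IsInvertible) :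
    TransverseAt γ ℓ x := by
  obtain ⟨v, hv, hv0⟩ := exists_radical_ne_zero hrad
  refine transverseAt_of_radical hsymm hrad hv fun hℓ ↦ hv0 ?_
  obtain ⟨e, he⟩ := h
  refine (map_eq_zero_iff e e.injective).1 (ContinuousLinearMap.ext fun w ↦ ?_)
  rw [← ContinuousLinearEquiv.coe_coe, he, completedForm_apply, hv, hℓ]
  simp

/-- Null metric hypersurface data exist locally. -/
theorem IsNullOn.exists_local_data (hγ : IsNullOn γ Set.univ) (x : N) :
    ∃ (V : Set N) (ℓ : CovectorField n N), IsOpen V ∧ x ∈ V ∧ IsNullDataOn γ ℓ 0 V := by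
  obtain ⟨v, hv, hv0⟩ := exists_radical_ne_zero (hγ.finrank_radical x trivial)
  obtain ⟨ℓ, hℓ, hx⟩ := exists_smooth_covector_ne_zero hv0
  have hγs (y : N) : SmoothTensorAt γ y := hγ.smooth.smoothTensorAt univ_mem
  have ht : TransverseAt γ ℓ x := transverseAt_of_radical (hγ.symm x trivial)
    (hγ.finrank_radical x trivial) hv hx
  have hev := ((hγs x).completedForm hℓ.self_of_nhds).eventually_isInvertible ht.isInvertible
  obtain ⟨V, hV, hVo, hxV⟩ := eventually_nhds_iff.1 (hℓ.and hev)
  refine ⟨V, ℓ, hVo, hxV, .of_transverseAt (hγ.mono (Set.subset_univ V))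
    (fun y hy ↦ (hV y hy).1.contMDiffWithinAt) contMDiffOn_const fun y hy ↦
    transverseAt_of_isInvertible (hγ.symm y trivial) (hγ.finrank_radical y trivial) (hV y hy).2⟩

theorem IsNullDataOn.isRuledOn (h : IsNullDataOn γ ℓ ℓ₂ U) (hU : IsOpen U) : IsRuledOn γ U where
  null := h.null
  exists_section := by
    refine ⟨nullVector γ ℓ, fun y hy ↦ ContMDiffAt.contMDiffWithinAt
      (h.regularDataAt hU hy).smoothFieldAt_nullVector,
      fun y hy ↦ ⟨(h.transverseAt hy).nullVector_spec.1, fun h0 ↦ ?_⟩⟩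
    have := (h.transverseAt hy).nullVector_spec.2
    rw [h0, map_zero] at this
    exact zero_ne_one this

end LocalData

/-! ### Descent of the connection along a radical double cover -/

section Descent

variable {n : ℕ} {N : Type u} [TopologicalSpace N]
  [ChartedSpace (EuclideanSpace ℝ (Fin n)) N] [IsManifold (𝓡 n) ∞ N]
  {C : Type u} [TopologicalSpace C]
  [ChartedSpace (EuclideanSpace ℝ (Fin n)) C] [IsManifold (𝓡 n) ∞ C]
  {f : C → N} {q : C} {x : N} {γ : TensorField n N} {ℓ ℓ' : CovectorField n N}
  {ℓC : CovectorField n C} {ℓ₂C : C → ℝ} {ℓ₂ : N → ℝ} {X Z W : VField n N}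

/-- The covector field on `N` whose value at `p` is the push-forward under `f` of the value of
`ℓC` at `g p`. It is only meaningful at the points `p` with `f (g p) = p`. -/
def pushCovector (f : C → N) (g : N → C) (ℓC : CovectorField n C) : CovectorField n N :=
  fun p ↦ (ℓC (g p)).comp (show TangentSpace (𝓡 n) p →L[ℝ] TangentSpace (𝓡 n) (g p) from
    (mfderiv (𝓡 n) (𝓡 n) f (g p)).inverse)

omit [IsManifold (𝓡 n) ∞ N] [IsManifold (𝓡 n) ∞ C] in
theorem pushCovector_apply {g : N → C} {p : N} (h : f (g p) = p) (X : VField n N) :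
    pushCovector f g ℓC p (X p) = ℓC (g p) (mpullback (𝓡 n) (𝓡 n) f X (g p)) := by
  have hX : (X p : EuclideanSpace ℝ (Fin n)) = X (f (g p)) :=
    congrArg (fun y ↦ (X y : EuclideanSpace ℝ (Fin n))) h.symm
  change ℓC (g p) ((mfderiv (𝓡 n) (𝓡 n) f (g p)).inverse (X p : EuclideanSpace ℝ (Fin n))) = _
  rw [hX]
  rfl

omit [IsManifold (𝓡 n) ∞ N] [IsManifold (𝓡 n) ∞ C] in
/-- A tangent vector upstairs is the value of a pulled-back field. The field downstairs need not be
smooth, as only pointwise identities are tested on it. -/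
theorem exists_mpullback_eq (hf : IsLocalDiffeomorphAt (𝓡 n) (𝓡 n) ∞ f q)
    (w : TangentSpace (𝓡 n) q) : ∃ X : VField n N, mpullback (𝓡 n) (𝓡 n) f X q = w :=
  ⟨fun _ ↦ (mfderiv (𝓡 n) (𝓡 n) f q w : EuclideanSpace ℝ (Fin n)),
    (isInvertible_mfderiv hf).inverse_apply_self w⟩

/-- Near each of its points, data on the source of a local diffeomorphism are pulled back from data
on the target. -/
theorem exists_local_pushforward (hf : IsLocalDiffeomorph (𝓡 n) (𝓡 n) ∞ f)
    (hγ : SmoothTensorAt γ (f q)) (hd : IsNullDataOn (pullbackTensor f γ) ℓC ℓ₂C Set.univ) :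
    ∃ ℓ : CovectorField n N, RegularDataAt γ ℓ (f q) ∧
      ∀ᶠ y in 𝓝 q, ℓC y = pullbackCovector f ℓ y := by
  set g := (hf q).localInverse with hg
  have hgq : g (f q) = q := (hf q).localInverse_left_inv (hf q).localInverse_mem_target
  have hsource : ∀ᶠ p in 𝓝 (f q), f (g p) = p := (hf q).localInverse_eventuallyEq_right
  have hℓ : ∀ᶠ y in 𝓝 q, ℓC y = pullbackCovector f (pushCovector f g ℓC) y := by
    filter_upwards [(hf q).localInverse_eventuallyEq_left] with y (hy : g (f y) = y)
    ext w
    obtain ⟨X, rfl⟩ := exists_mpullback_eq (hf y) w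
    rw [pullbackCovector_mpullback (hf y), pushCovector_apply (by rw [hy])]
    exact congrArg (fun y ↦ ℓC y (mpullback (𝓡 n) (𝓡 n) f X y)) hy.symm
  refine ⟨pushCovector f g ℓC, ⟨hγ, SmoothCovectorAt.of_apply fun X hX ↦ ?_, ?_⟩, hℓ⟩
  · have h1 : ContMDiffAt (𝓡 n) 𝓘(ℝ, ℝ) ∞ (fun y ↦ ℓC y (mpullback (𝓡 n) (𝓡 n) f X y))
        (g (f q)) := by
      rw [hgq]
      exact (hd.smooth_covector.smoothCovectorAt univ_mem).apply
        (hX.self_of_nhds.mpullback (hf q))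
    refine (h1.comp (f q) (hf q).localInverse_contMDiffAt).congr_of_eventuallyEq ?_
    filter_upwards [hsource] with p hp
    exact pushCovector_apply hp X
  · refine hf.isOpenMap.nhds_le q (eventually_map.2 ?_)
    filter_upwards [hℓ] with y hy
    exact (transverseAt_pullback_iff (hf y)).1 ((hd.transverseAt trivial).congr hy)

omit [IsManifold (𝓡 n) ∞ N] in
/-- The push-forwards of compatible data from two sheets agree up to a sign. -/
theorem IsCompatibleData.eq_or_neg (hc : IsCompatibleData γ f ℓC ℓ₂C)
    (hf : IsLocalDiffeomorph (𝓡 n) (𝓡 n) ∞ f) {q₁ q₂ : C} (h : f q₂ = f q₁)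
    {ℓ : CovectorField n N} (h₁ : ℓC q₁ = pullbackCovector f ℓ q₁)
    {α : TangentSpace (𝓡 n) (f q₁) →L[ℝ] ℝ}
    (h₂ : ∀ X : VField n N, α (X (f q₁)) = ℓC q₂ (mpullback (𝓡 n) (𝓡 n) f X q₂)) :
    α = ℓ (f q₁) ∨ α = -ℓ (f q₁) := by
  obtain ⟨ε, hε, hs⟩ := hc.sign q₁ q₂ h.symm
  have key (v : TangentSpace (𝓡 n) (f q₁)) : α v = ε * ℓ (f q₁) v := by
    set V : VField n N := fun _ ↦ (v : EuclideanSpace ℝ (Fin n))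
    have := h₂ V
    rwa [hs V, h₁, pullbackCovector_mpullback (hf q₁)] at this
  rcases hε with rfl | rfl
  · left; ext v; rw [key, one_mul]
  · right; ext v; rw [key, neg_one_mul, neg_apply]

/-- The operator `Z ↦ df ∘ ∇(f^⋆ Z)|_q ∘ df⁻¹` at `f q`. It is typed over an arbitrary point `x`,
and meaningful for `x = f q`, so that the operators of two points in a fibre can be compared. -/
def pushConnection (f : C → N) (covC : RawConnection n C) (q : C) (x : N) (Z : VField n N) :
    TangentSpace (𝓡 n) x →L[ℝ] TangentSpace (𝓡 n) x :=
  (show TangentSpace (𝓡 n) q →L[ℝ] TangentSpace (𝓡 n) x from mfderiv (𝓡 n) (𝓡 n) f q).comp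
    ((covC (mpullback (𝓡 n) (𝓡 n) f Z) q).comp
      (show TangentSpace (𝓡 n) x →L[ℝ] TangentSpace (𝓡 n) q from
        (mfderiv (𝓡 n) (𝓡 n) f q).inverse))

omit [IsManifold (𝓡 n) ∞ N] [IsManifold (𝓡 n) ∞ C] in
theorem pushConnection_mfderiv (hf : IsLocalDiffeomorphAt (𝓡 n) (𝓡 n) ∞ f q)
    (covC : RawConnection n C) (Z : VField n N) (v : TangentSpace (𝓡 n) q) :
    pushConnection f covC q (f q) Z (mfderiv (𝓡 n) (𝓡 n) f q v) =
      mfderiv (𝓡 n) (𝓡 n) f q (covC (mpullback (𝓡 n) (𝓡 n) f Z) q v) := by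
  change mfderiv (𝓡 n) (𝓡 n) f q (covC (mpullback (𝓡 n) (𝓡 n) f Z) q
    ((mfderiv (𝓡 n) (𝓡 n) f q).inverse (mfderiv (𝓡 n) (𝓡 n) f q v))) = _
  rw [(isInvertible_mfderiv hf).inverse_apply_self]

theorem pushConnection_add {covC : RawConnection n C}
    (hcov : IsCovariantDerivativeOn (I := 𝓡 n) (EuclideanSpace ℝ (Fin n)) covC Set.univ)
    (hf : IsLocalDiffeomorphAt (𝓡 n) (𝓡 n) ∞ f q) (hx : f q = x)
    (hX : DiffFieldAt X x) (hZ : DiffFieldAt Z x) :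
    pushConnection f covC q x (X + Z) = pushConnection f covC q x X + pushConnection f covC q x Z := by
  subst hx
  simp only [pushConnection]
  rw [mpullback_add, hcov.add (hX.mpullback hf) (hZ.mpullback hf), ContinuousLinearMap.add_comp,
    ContinuousLinearMap.comp_add]

theorem pushConnection_smul {covC : RawConnection n C}
    (hcov : IsCovariantDerivativeOn (I := 𝓡 n) (EuclideanSpace ℝ (Fin n)) covC Set.univ)
    (hf : IsLocalDiffeomorphAt (𝓡 n) (𝓡 n) ∞ f q) (hx : f q = x) {φ : N → ℝ}
    (hφ : MDifferentiableAt (𝓡 n) 𝓘(ℝ, ℝ) φ x) (hZ : DiffFieldAt Z x) :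
    pushConnection f covC q x (φ • Z) =
      φ x • pushConnection f covC q x Z + (mvfderiv (𝓡 n) φ x).smulRight (Z x) := by
  subst hx
  ext v
  obtain ⟨w, rfl⟩ := (isInvertible_mfderiv hf).surjective v
  simp only [add_apply, smul_apply, pushConnection_mfderiv hf, ContinuousLinearMap.smulRight_apply]
  rw [mpullback_smul, hcov.leibniz (hZ.mpullback hf)
    (hφ.comp q (hf.mdifferentiableAt (by simp)))]
  simp only [add_apply, smul_apply, ContinuousLinearMap.smulRight_apply, map_add, map_smul,
    mfderiv_mpullback hf, Function.comp_apply]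
  rw [mvfderiv_comp_apply q hφ (hf.mdifferentiableAt (by simp))]

/-- The push-forward from the sheet through `q` of the metric hypersurface connection satisfies the
Koszul equations of the push-forward of the data. -/
theorem satisfiesKoszulAt_pushConnection (hf : IsLocalDiffeomorph (𝓡 n) (𝓡 n) ∞ f)
    (hd : IsNullDataOn (pullbackTensor f γ) ℓC ℓ₂C Set.univ) (hℓ₂ : ℓ₂C q = ℓ₂ (f q))
    {covC : RawConnection n C}
    (hcov : IsMetricHypersurfaceConnectionOn (pullbackTensor f γ) ℓC ℓ₂C covC Set.univ)
    (hr : RegularDataAt γ ℓ (f q)) (hℓ : ∀ᶠ y in 𝓝 q, ℓC y = pullbackCovector f ℓ y) :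
    SatisfiesKoszulAt γ ℓ ℓ₂ (f q) (pushConnection f covC q (f q)) :=
  SatisfiesKoszulAt.of_pullback hf hr hℓ hℓ₂
    (fun Z _ v ↦ (pushConnection_mfderiv (hf q) covC Z v).symm)
    (((isMetricHypersurfaceConnectionOn_iff isOpen_univ hd).1 hcov).2 q trivial)

/-- The connections pushed forward from two points of a fibre agree: their data downstairs differ by
a sign, so they satisfy the same Koszul equations. -/
theorem IsCompatibleData.pushConnection_eq (hc : IsCompatibleData γ f ℓC ℓ₂C)
    (hf : IsLocalDiffeomorph (𝓡 n) (𝓡 n) ∞ f) (hγ : IsNullOn γ Set.univ) {covC : RawConnection n C}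
    (hcov : IsMetricHypersurfaceConnectionOn (pullbackTensor f γ) ℓC ℓ₂C covC Set.univ)
    {q₁ q₂ : C} (h₁ : f q₁ = x) (h₂ : f q₂ = x) (hZ : SmoothFieldAt Z x) :
    pushConnection f covC q₁ x Z = pushConnection f covC q₂ x Z := by
  obtain ⟨ℓ₂, -, hℓ₂⟩ := hc.descends
  have hγs (y : N) : SmoothTensorAt γ y := hγ.smooth.smoothTensorAt univ_mem
  obtain ⟨ℓ, hr, hℓ⟩ := exists_local_pushforward hf (hγs (f q₁)) hc.data
  obtain ⟨ℓ', hr', hℓ'⟩ := exists_local_pushforward hf (hγs (f q₂)) hc.data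
  have hk := satisfiesKoszulAt_pushConnection hf hc.data (hℓ₂ q₁) hcov hr hℓ
  have hk' := satisfiesKoszulAt_pushConnection hf hc.data (hℓ₂ q₂) hcov hr' hℓ'
  rw [h₁] at hr hk
  rw [h₂] at hr' hk'
  have e₁ : ∀ᶠ p in 𝓝 x, ∃ y, f y = p ∧ ℓC y = pullbackCovector f ℓ y :=
    h₁ ▸ hf.isOpenMap.nhds_le q₁ (eventually_map.2 (hℓ.mono fun y hy ↦ ⟨y, rfl, hy⟩))
  have e₂ : ∀ᶠ p in 𝓝 x, ∃ y, f y = p ∧ ℓC y = pullbackCovector f ℓ' y :=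
    h₂ ▸ hf.isOpenMap.nhds_le q₂ (eventually_map.2 (hℓ'.mono fun y hy ↦ ⟨y, rfl, hy⟩))
  have hs : ∀ᶠ p in 𝓝 x, ℓ' p = ℓ p ∨ ℓ' p = -ℓ p := by
    filter_upwards [e₁, e₂] with p ⟨y₁, hy₁, hℓ₁⟩ ⟨y₂, hy₂, hℓ₂⟩
    subst hy₁
    refine hc.eq_or_neg hf hy₂ hℓ₁ fun X ↦ ?_
    rw [hℓ₂, pullbackCovector_mpullback (hf y₂), hy₂]
  exact (hk.of_eq_or_neg hr hr'.smooth_covector hs).eq_of_transverseAt hk'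
    hr'.transverse.self_of_nhds hZ

omit [IsManifold (𝓡 n) ∞ N] in
theorem IsRadicalDoubleCover.surjective (hf : IsRadicalDoubleCover γ f) : Function.Surjective f := by
  intro p
  have h : (f ⁻¹' {p}).Nonempty := Set.nonempty_of_ncard_ne_zero (by rw [hf.two_sheets]; norm_num)
  exact h

/-- The descended connection is defined by an arbitrary set-theoretic section of the cover, on
which it does not depend for smooth fields. -/
theorem IsCompatibleData.exists_descendsTo (hc : IsCompatibleData γ f ℓC ℓ₂C)
    (hf : IsRadicalDoubleCover γ f) (hγ : IsNullOn γ Set.univ) {covC : Connection n C}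
    (hcov : IsMetricHypersurfaceConnectionOn (pullbackTensor f γ) ℓC ℓ₂C covC Set.univ) :
    ∃ cov : Connection n N, DescendsTo f covC cov := by
  obtain ⟨s, hs⟩ := hf.surjective.hasRightInverse
  refine ⟨⟨fun Z x ↦ pushConnection f covC (s x) x Z, ?_, ?_⟩, fun q Z hZ v ↦ ?_⟩
  · intro X Z x hX hZ _
    exact pushConnection_add covC.isCovariantDerivativeOnUniv (hf.isLocalDiffeomorph _) (hs x) hX hZ
  · intro Z φ x hZ hφ _
    exact pushConnection_smul covC.isCovariantDerivativeOnUniv (hf.isLocalDiffeomorph _) (hs x)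
      hφ hZ
  · change _ = pushConnection f covC (s (f q)) (f q) Z _
    rw [hc.pushConnection_eq hf.isLocalDiffeomorph hγ hcov (hs (f q)) rfl hZ,
      pushConnection_mfderiv (hf.isLocalDiffeomorph q)]

theorem DescendsTo.eq {covC : Connection n C} {cov cov' : Connection n N}
    (h : DescendsTo f covC cov) (h' : DescendsTo f covC cov')
    (hf : IsRadicalDoubleCover γ f) (hZ : SmoothFieldAt Z x) : cov' Z x = cov Z x := by
  obtain ⟨q, rfl⟩ := hf.surjective x
  ext v
  obtain ⟨w, rfl⟩ := (isInvertible_mfderiv (hf.isLocalDiffeomorph q)).surjective v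
  rw [← h q Z hZ, ← h' q Z hZ]

end Descent

/-! ### The family of descended connections -/

section Family

variable {n : ℕ} {N : Type u} [TopologicalSpace N]
  [ChartedSpace (EuclideanSpace ℝ (Fin n)) N] [IsManifold (𝓡 n) ∞ N]
  {C : Type u} [TopologicalSpace C]
  [ChartedSpace (EuclideanSpace ℝ (Fin n)) C] [IsManifold (𝓡 n) ∞ C]
  {f : C → N} {q : C} {x : N} {U : Set N} {γ : TensorField n N} {ℓ ℓ' : CovectorField n N}
  {ℓC : CovectorField n C} {ℓ₂C : C → ℝ} {ℓ₂ : N → ℝ} {X Z W : VField n N}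

theorem DescendsTo.satisfiesKoszulAt {covC : Connection n C} {cov : Connection n N}
    (hdesc : DescendsTo f covC cov) (hf : IsLocalDiffeomorph (𝓡 n) (𝓡 n) ∞ f)
    (hd : IsNullDataOn (pullbackTensor f γ) ℓC ℓ₂C Set.univ) (hℓ₂ : ℓ₂C q = ℓ₂ (f q))
    (hcov : IsMetricHypersurfaceConnectionOn (pullbackTensor f γ) ℓC ℓ₂C covC Set.univ)
    (hr : RegularDataAt γ ℓ (f q)) (hℓ : ∀ᶠ y in 𝓝 q, ℓC y = pullbackCovector f ℓ y) :
    SatisfiesKoszulAt γ ℓ ℓ₂ (f q) (fun Z ↦ cov Z (f q)) :=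
  SatisfiesKoszulAt.of_pullback hf hr hℓ hℓ₂ (fun Z hZ v ↦ hdesc q Z hZ v)
    (((isMetricHypersurfaceConnectionOn_iff isOpen_univ hd).1 hcov).2 q trivial)

/-- The push-forward along the set-theoretic section `s` of `f`, with the sign chosen such that it
is positive on the field `X`. -/
def orientedPushCovector (f : C → N) (s : N → C) (ℓC : CovectorField n C) (X : VField n N) :
    CovectorField n N :=
  fun p ↦ (SignType.sign (pushCovector f s ℓC p (X p)) : ℝ) • pushCovector f s ℓC p

/-- The choice of signs makes the push-forward of compatible data smooth. -/
theorem IsCompatibleData.exists_eventually_eq_orientedPushCovector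
    (hc : IsCompatibleData γ f ℓC ℓ₂C) (hf : IsLocalDiffeomorph (𝓡 n) (𝓡 n) ∞ f)
    {s : N → C} (hs : Function.RightInverse s f) (hX : SmoothFieldAt X x)
    (hXr : γ x (X x) = 0) (hX0 : X x ≠ 0) (hq : f q = x) (hr : RegularDataAt γ ℓ x)
    (hℓ : ∀ᶠ y in 𝓝 q, ℓC y = pullbackCovector f ℓ y) :
    (∀ᶠ y in 𝓝 x, ℓ y = orientedPushCovector f s ℓC X y) ∨
      ∀ᶠ y in 𝓝 x, (-ℓ) y = orientedPushCovector f s ℓC X y := by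
  have hpush : ∀ᶠ p in 𝓝 x, pushCovector f s ℓC p = ℓ p ∨ pushCovector f s ℓC p = -ℓ p := by
    have e : ∀ᶠ p in 𝓝 x, ∃ y, f y = p ∧ ℓC y = pullbackCovector f ℓ y :=
      hq ▸ hf.isOpenMap.nhds_le q (eventually_map.2 (hℓ.mono fun y hy ↦ ⟨y, rfl, hy⟩))
    filter_upwards [e] with p ⟨y, hy, hℓy⟩
    subst hy
    exact hc.eq_or_neg hf (hs (f y)) hℓy fun X ↦ pushCovector_apply (hs (f y)) X
  have hcont : ContinuousAt (fun y ↦ ℓ y (X y)) x := (hr.smooth_covector.apply hX).continuousAt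
  have hne : ℓ x (X x) ≠ 0 := fun h ↦ hX0 (hr.transverse.self_of_nhds.eq_zero _ hXr h)
  rcases hne.lt_or_gt with hneg | hpos
  · right
    filter_upwards [hpush, hcont.eventually_lt_const hneg] with y hy hneg
    rcases hy with hy | hy
    · rw [orientedPushCovector, hy, sign_neg hneg]
      ext v
      simp
    · rw [orientedPushCovector, hy, neg_apply, sign_pos (neg_pos.2 hneg)]
      ext v
      simp
  · left
    filter_upwards [hpush, hcont.eventually_const_lt hpos] with y hy hpos
    rcases hy with hy | hy
    · rw [orientedPushCovector, hy, sign_pos hpos]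
      ext v
      simp
    · rw [orientedPushCovector, hy, neg_apply, sign_neg (neg_neg_iff_pos.2 hpos)]
      ext v
      simp

/-- On a ruled open set a connection of the descended family is a metric hypersurface connection. -/
theorem exists_data_of_mem_descendedFamily (hf : IsRadicalDoubleCover γ f)
    (hγ : IsNullOn γ Set.univ) {cov : Connection n N} (hcov : cov ∈ descendedFamily γ f)
    (hU : IsOpen U) (hruled : IsRuledOn γ U) :
    ∃ (ℓ : CovectorField n N) (ℓ₂ : N → ℝ), IsNullDataOn γ ℓ ℓ₂ U ∧
      IsMetricHypersurfaceConnectionOn γ ℓ ℓ₂ cov U := by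
  obtain ⟨ℓC, ℓ₂C, covC, hc, hcovC, hdesc⟩ := hcov
  obtain ⟨ℓ₂, hℓ₂s, hℓ₂⟩ := hc.descends
  obtain ⟨X, hX, hXr⟩ := hruled.exists_section
  obtain ⟨s, hs⟩ := hf.surjective.hasRightInverse
  have hloc := hf.isLocalDiffeomorph
  have key (x) (hx : x ∈ U) : RegularDataAt γ (orientedPushCovector f s ℓC X) x ∧
      SatisfiesKoszulAt γ (orientedPushCovector f s ℓC X) ℓ₂ x (fun Z ↦ cov Z x) := by
    obtain ⟨ℓ, hr, hℓ⟩ := exists_local_pushforward (q := s x) hloc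
      (hγ.smooth.smoothTensorAt univ_mem) hc.data
    have hk := hdesc.satisfiesKoszulAt hloc hc.data (hℓ₂ (s x)) hcovC hr hℓ
    rw [hs x] at hr hk
    rcases hc.exists_eventually_eq_orientedPushCovector hloc hs
      (hX.smoothFieldAt (hU.mem_nhds hx)) (hXr x hx).1 (hXr x hx).2 (hs x) hr hℓ with he | he
    · exact ⟨hr.congr he, hk.congr he rfl⟩
    · exact ⟨hr.neg.congr he, (hk.neg hr).congr he rfl⟩
  have hd : IsNullDataOn γ (orientedPushCovector f s ℓC X) ℓ₂ U :=
    .of_transverseAt hruled.null (fun x hx ↦ (key x hx).1.smooth_covector.contMDiffWithinAt)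
      hℓ₂s.contMDiffOn fun x hx ↦ (key x hx).1.transverse.self_of_nhds
  exact ⟨_, ℓ₂, hd, (isMetricHypersurfaceConnectionOn_iff hU hd).2
    ⟨cov.isCovariantDerivativeOnUniv.mono (Set.subset_univ U), fun x hx ↦ (key x hx).2⟩⟩

/-- Being smooth and torsion-free is local, and every null manifold is locally ruled. -/
theorem contMDiff_and_torsion_eq_zero (hf : IsRadicalDoubleCover γ f)
    (hγ : IsNullOn γ Set.univ) {cov : Connection n N} (hcov : cov ∈ descendedFamily γ f) :
    CovariantDerivative.ContMDiffCovariantDerivative cov ∞ ∧ cov.torsion = 0 := by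
  have key (x : N) : ∃ V : Set N, IsOpen V ∧ x ∈ V ∧
      ∃ ℓ ℓ₂, IsMetricHypersurfaceConnectionOn γ ℓ ℓ₂ cov V := by
    obtain ⟨V, ℓ, hV, hxV, hd⟩ := hγ.exists_local_data x
    obtain ⟨ℓ', ℓ₂', -, h⟩ := exists_data_of_mem_descendedFamily hf hγ hcov hV (hd.isRuledOn hV)
    exact ⟨V, hV, hxV, ℓ', ℓ₂', h⟩
  refine ⟨⟨⟨fun {Z} hZ x _ ↦ ?_⟩⟩, ?_⟩
  · obtain ⟨V, hV, hxV, ℓ', ℓ₂', h⟩ := key x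
    exact ((h.smooth.contMDiff (hZ.mono (Set.subset_univ V))).contMDiffAt
      (hV.mem_nhds hxV)).contMDiffWithinAt
  · funext x
    obtain ⟨V, hV, hxV, ℓ', ℓ₂', h⟩ := key x
    ext v w
    obtain ⟨X, hX, rfl⟩ := exists_smooth_extension v
    obtain ⟨Z, hZ, rfl⟩ := exists_smooth_extension w
    rw [CovariantDerivative.torsion_apply _ hX.self_of_nhds.diffFieldAt
      hZ.self_of_nhds.diffFieldAt]
    exact sub_eq_zero.2 (h.torsionFree x hxV X Z hX.self_of_nhds hZ.self_of_nhds)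

theorem SmoothCovectorAt.pullback (hℓ : SmoothCovectorAt ℓ (f q))
    (hf : IsLocalDiffeomorphAt (𝓡 n) (𝓡 n) ∞ f q) : SmoothCovectorAt (pullbackCovector f ℓ) q := by
  refine SmoothCovectorAt.of_apply fun X hX ↦ ?_
  have := ContMDiffAt.clm_bundle_apply (E₁ := (TangentSpace (𝓡 n) : N → Type _))
    (E₂ := Bundle.Trivial N ℝ) (b := f) (ϕ := fun y ↦ ℓ (f y))
    (ContMDiffAt.comp q hℓ hf.contMDiffAt) (contMDiffAt_mfderiv_apply hf.contMDiffAt hX.self_of_nhds)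
  rw [contMDiffAt_totalSpace] at this
  exact this.2

theorem SmoothTensorAt.pullback (hγ : SmoothTensorAt γ (f q))
    (hf : IsLocalDiffeomorphAt (𝓡 n) (𝓡 n) ∞ f q) : SmoothTensorAt (pullbackTensor f γ) q := by
  refine SmoothTensorAt.of_apply fun X Z hX hZ ↦ ?_
  have h1 := ContMDiffAt.clm_bundle_apply (E₁ := (TangentSpace (𝓡 n) : N → Type _))
    (E₂ := fun y : N ↦ TangentSpace (𝓡 n) y →L[ℝ] ℝ) (b := f) (ϕ := fun y ↦ γ (f y))
    (ContMDiffAt.comp q hγ hf.contMDiffAt) (contMDiffAt_mfderiv_apply hf.contMDiffAt hX.self_of_nhds)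
  have := ContMDiffAt.clm_bundle_apply (E₁ := (TangentSpace (𝓡 n) : N → Type _))
    (E₂ := Bundle.Trivial N ℝ) (b := f)
    (ϕ := fun y ↦ γ (f y) (mfderiv (𝓡 n) (𝓡 n) f y (X y)))
    h1 (contMDiffAt_mfderiv_apply hf.contMDiffAt hZ.self_of_nhds)
  rw [contMDiffAt_totalSpace] at this
  exact this.2

theorem IsNullDataOn.isCompatibleData_pullback (hd : IsNullDataOn γ ℓ ℓ₂ Set.univ)
    (hf : IsRadicalDoubleCover γ f) :
    IsCompatibleData γ f (pullbackCovector f ℓ) (ℓ₂ ∘ f) where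
  data := .of_transverseAt hf.ruled.null
    (fun q _ ↦ ContMDiffAt.contMDiffWithinAt
      ((hd.smooth_covector.smoothCovectorAt univ_mem).pullback (hf.isLocalDiffeomorph q)))
    ((contMDiffOn_univ.1 hd.smooth_scalar).comp hf.isLocalDiffeomorph.contMDiff).contMDiffOn
    fun q _ ↦ (transverseAt_pullback_iff (hf.isLocalDiffeomorph q)).2 (hd.transverseAt trivial)
  sign q₁ q₂ h := by
    refine ⟨1, .inl rfl, fun V ↦ ?_⟩
    rw [pullbackCovector_mpullback (hf.isLocalDiffeomorph q₁),
      pullbackCovector_mpullback (hf.isLocalDiffeomorph q₂), h, one_mul]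
  descends := ⟨ℓ₂, contMDiffOn_univ.1 hd.smooth_scalar, fun _ ↦ rfl⟩

/-- On a ruled `N`, data pull back to compatible data, whose connection descends to the connection of
the original data by uniqueness of the solution of the Koszul equations. -/
theorem descendedFamily_eq_of_isRuledOn (hf : IsRadicalDoubleCover γ f)
    (hruled : IsRuledOn γ Set.univ) : descendedFamily γ f = metricHypersurfaceFamily γ := by
  refine Set.Subset.antisymm (fun cov hcov ↦
    exists_data_of_mem_descendedFamily hf hruled.null hcov isOpen_univ hruled) ?_
  rintro cov ⟨ℓ, ℓ₂, hd, hcov⟩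
  have hloc := hf.isLocalDiffeomorph
  have hc := hd.isCompatibleData_pullback hf
  obtain ⟨covC, hcovC⟩ := exists_metricHypersurfaceConnection hc.data
  refine ⟨_, _, covC, hc, hcovC, fun q Z hZ v ↦ ?_⟩
  have hr := hd.regularDataAt isOpen_univ (Set.mem_univ (f q))
  have h1 := satisfiesKoszulAt_pushConnection (ℓ₂ := ℓ₂) hloc hc.data rfl hcovC hr
    (Eventually.of_forall fun _ ↦ rfl)
  have h2 := ((isMetricHypersurfaceConnectionOn_iff isOpen_univ hd).1 hcov).2 (f q) trivial
  rw [← pushConnection_mfderiv (hloc q), h1.eq_of_transverseAt h2 hr.transverse.self_of_nhds hZ]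

end Family

/-! ### Existence of compatible data -/

section CompatibleData

variable {n : ℕ} {N : Type u} [TopologicalSpace N]
  [ChartedSpace (EuclideanSpace ℝ (Fin n)) N] [IsManifold (𝓡 n) ∞ N]
  {C : Type u} [TopologicalSpace C]
  [ChartedSpace (EuclideanSpace ℝ (Fin n)) C] [IsManifold (𝓡 n) ∞ C]
  {f : C → N} {q : C} {x : N} {U : Set N} {γ : TensorField n N}

omit [IsManifold (𝓡 n) ∞ N] in
theorem convex_posRadical (γ : TensorField n N) (x : N) :
    Convex ℝ {β : TangentSpace (𝓡 n) x →L[ℝ] TangentSpace (𝓡 n) x →L[ℝ] ℝ |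
      ∀ v, γ x v = 0 → v ≠ 0 → 0 < β v v} := by
  intro β hβ β' hβ' a b ha hb hab v hv hv0
  have h1 := hβ v hv hv0
  have h2 := hβ' v hv hv0
  change 0 < a * β v v + b * β' v v
  rcases ha.eq_or_lt with rfl | ha
  · rw [zero_add] at hab
    rw [hab]
    linarith
  · have := mul_nonneg hb h2.le
    have := mul_pos ha h1
    linarith

set_option synthInstance.maxHeartbeats 400000 in
set_option maxHeartbeats 1000000 in
/-- The forms that are positive on the radical are convex, and `γ + ℓ ⊗ ℓ` is a local one, so a
partition of unity yields a global one. -/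
theorem IsNullOn.exists_pos_on_radical [T2Space N] [SecondCountableTopology N]
    (hγ : IsNullOn γ Set.univ) : ∃ β : TensorField n N, SmoothTensorOn β Set.univ ∧
      ∀ x v, γ x v = 0 → v ≠ 0 → 0 < β x v v := by
  have : LocallyCompactSpace N :=
    ChartedSpace.locallyCompactSpace (EuclideanSpace ℝ (Fin n)) N
  obtain ⟨β, hβ⟩ := exists_contMDiffSection_forall_mem_convex_of_local (𝓡 n) (n := ⊤)
    (F_fiber := EuclideanSpace ℝ (Fin n) →L[ℝ] EuclideanSpace ℝ (Fin n) →L[ℝ] ℝ)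
    (fun x : N ↦ TangentSpace (𝓡 n) x →L[ℝ] TangentSpace (𝓡 n) x →L[ℝ] ℝ)
    (fun x ↦ {β | ∀ v, γ x v = 0 → v ≠ 0 → 0 < β v v}) (convex_posRadical γ) fun x ↦ by
      obtain ⟨V, ℓ, hV, hxV, hd⟩ := hγ.exists_local_data x
      refine ⟨V, hV.mem_nhds hxV, completedForm γ ℓ, fun y hy ↦ ?_, fun y hy v hv hv0 ↦ ?_⟩
      · have hr := hd.regularDataAt hV hy
        exact (hr.smooth_tensor.completedForm hr.smooth_covector).contMDiffWithinAt
      · have : ℓ y v ≠ 0 := fun h ↦ hv0 ((hd.transverseAt hy).eq_zero v hv h)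
        rw [completedForm_apply, hv, zero_apply, zero_add]
        exact mul_self_pos.2 this
  exact ⟨β, β.contMDiff.contMDiffOn, hβ⟩

/-- If `X` spans the radical on the cover and `b = f^⋆ β` is positive on the radical, the covector
`b(X, ·) / √b(X, X)` depends on `X` only through its direction. At the two points of a fibre the
push-forwards of `X` are proportional, whence the sign condition. -/
theorem IsRadicalDoubleCover.exists_isCompatibleData [T2Space N] [SecondCountableTopology N]
    (hf : IsRadicalDoubleCover γ f) (hγ : IsNullOn γ Set.univ) :
    ∃ ℓ : CovectorField n C, IsCompatibleData γ f ℓ 0 := by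
  obtain ⟨β, hβ, hpos⟩ := hγ.exists_pos_on_radical
  obtain ⟨X, hX, hXr⟩ := hf.ruled.exists_section
  have hloc := hf.isLocalDiffeomorph
  set b := pullbackTensor f β with hb
  -- `X q` is the pull-back of a field on `N` that spans the radical at `f q`
  have hY (q : C) : ∃ Y : VField n N, mpullback (𝓡 n) (𝓡 n) f Y q = X q ∧
      γ (f q) (Y (f q)) = 0 ∧ Y (f q) ≠ 0 := by
    obtain ⟨Y, hY⟩ := exists_mpullback_eq (hloc q) (X q)
    refine ⟨Y, hY, ?_, fun h ↦ (hXr q trivial).2 ?_⟩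
    · ext v
      obtain ⟨w, rfl⟩ := (isInvertible_mfderiv (hloc q)).surjective v
      have h0 : pullbackTensor f γ q (X q) = 0 := (hXr q trivial).1
      have := congrArg (fun L : TangentSpace (𝓡 n) q →L[ℝ] ℝ ↦ L w) h0
      rw [← hY] at this
      rw [← mfderiv_mpullback (hloc q) Y]
      exact this
    · rw [← hY, mpullback_apply, h, map_zero]
  have hbpos (q : C) : 0 < b q (X q) (X q) := by
    obtain ⟨Y, hY, hY0, hYne⟩ := hY q
    rw [← hY, hb, pullbackTensor_mpullback (hloc q)]
    exact hpos _ _ hY0 hYne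
  refine ⟨fun q ↦ (Real.sqrt (b q (X q) (X q)))⁻¹ • b q (X q),
    .of_transverseAt hf.ruled.null (fun q _ ↦ ?_) contMDiffOn_const fun q _ ↦ ?_,
    fun q₁ q₂ h ↦ ?_, 0, contMDiff_const, fun _ ↦ rfl⟩
  · have hbs := (hβ.smoothTensorAt (x := f q) univ_mem).pullback (hloc q)
    have hXs : SmoothFieldAt X q := hX.smoothFieldAt univ_mem
    refine ContMDiffAt.contMDiffWithinAt (SmoothCovectorAt.of_apply fun W hW ↦ ?_)
    have hsqrt := (Real.contDiffAt_sqrt (n := ∞) (hbpos q).ne').contMDiffAt.comp q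
      (hbs.apply₂ hXs hXs)
    exact (hsqrt.inv₀ (Real.sqrt_pos.2 (hbpos q)).ne').mul (hbs.apply₂ hXs hW.self_of_nhds)
  · refine transverseAt_of_radical (hf.ruled.null.symm q trivial)
      (hf.ruled.null.finrank_radical q trivial) (v := X q) (hXr q trivial).1 ?_
    exact mul_ne_zero (inv_ne_zero (Real.sqrt_pos.2 (hbpos q)).ne') (hbpos q).ne'
  · obtain ⟨Y', hY', hY0', hYne'⟩ := hY q₂
    obtain ⟨Y, hY, hY0, hYne⟩ := hY q₁
    have key (q) (V Y : VField n N) (hY : mpullback (𝓡 n) (𝓡 n) f Y q = X q) :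
        ((Real.sqrt (b q (X q) (X q)))⁻¹ • b q (X q)) (mpullback (𝓡 n) (𝓡 n) f V q) =
        (Real.sqrt (β (f q) (Y (f q)) (Y (f q))))⁻¹ * β (f q) (Y (f q)) (V (f q)) := by
      rw [smul_apply, smul_eq_mul, ← hY, hb, pullbackTensor_mpullback (hloc q),
        pullbackTensor_mpullback (hloc q)]
    rw [← h] at hY0' hYne'
    obtain ⟨c, hc⟩ := exists_smul_of_radical (hγ.finrank_radical (f q₁) trivial) hY0 hYne hY0'
    have hc0 : c ≠ 0 := by
      rintro rfl
      exact hYne' (by rw [hc, zero_smul])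
    -- the sign is that of the factor `c` between the two push-forwards of `X`
    refine ⟨c / |c|, ?_, fun V ↦ ?_⟩
    · rcases hc0.lt_or_gt with h | h
      · right; rw [abs_of_neg h, div_neg, div_self hc0]
      · left; rw [abs_of_pos h, div_self hc0]
    · rw [key q₂ V Y' hY', key q₁ V Y hY, ← h, hc]
      simp only [map_smul, smul_apply, smul_eq_mul]
      rw [← mul_assoc c c, Real.sqrt_mul (mul_self_nonneg c), Real.sqrt_mul_self_eq_abs, mul_inv]
      ring

end CompatibleData

/-! ### The smooth structure lifted by a local homeomorphism -/

section LiftedStructure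

variable {n : ℕ} {N : Type u} [TopologicalSpace N]
  [ChartedSpace (EuclideanSpace ℝ (Fin n)) N]
  {C : Type u} [TopologicalSpace C] {f : C → N}

/-- The charts `φ ∘ f` on the source of a local homeomorphism `f`, for charts `φ` of the target. -/
abbrev liftedChartedSpace (hf : IsLocalHomeomorph f) :
    ChartedSpace (EuclideanSpace ℝ (Fin n)) C where
  atlas := {c | ∃ e : OpenPartialHomeomorph C N, f = e ∧
    ∃ φ ∈ atlas (EuclideanSpace ℝ (Fin n)) N, c = e ≫ₕ φ}
  chartAt q := (hf q).choose ≫ₕ chartAt (EuclideanSpace ℝ (Fin n)) (f q)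
  mem_chart_source q := by
    have h := (hf q).choose_spec
    rw [OpenPartialHomeomorph.trans_source]
    refine ⟨h.1, ?_⟩
    rw [Set.mem_preimage, ← h.2]
    exact mem_chart_source _ _
  chart_mem_atlas q := ⟨_, (hf q).choose_spec.2, _, chart_mem_atlas _ _, rfl⟩

theorem isManifold_liftedChartedSpace [IsManifold (𝓡 n) ∞ N] (hf : IsLocalHomeomorph f) :
    letI := liftedChartedSpace (n := n) hf
    IsManifold (𝓡 n) ∞ C := by
  let _ := liftedChartedSpace (n := n) hf
  refine isManifold_of_contDiffOn (𝓡 n) ∞ C ?_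
  rintro _ _ ⟨e, he, φ, hφ, rfl⟩ ⟨e', he', φ', hφ', rfl⟩
  have h := (contDiffGroupoid ∞ (𝓡 n)).compatible hφ hφ'
  rw [contDiffGroupoid, mem_groupoid_of_pregroupoid] at h
  -- `e` and `e'` are restrictions of the same map, so their transition is the identity
  have key {z : N} (hz : z ∈ e.target) : e' (e.symm z) = z := by
    rw [← he', he, e.right_inv hz]
  refine (h.1 : ContDiffOn ℝ ∞ _ _).congr_mono (fun x hx ↦ ?_) (fun x hx ↦ ⟨?_, hx.2⟩)
  · exact congrArg φ' (key hx.1.1.2)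
  · have h2 : e' (e.symm (φ.symm x)) ∈ φ'.source := hx.1.2.2
    exact ⟨hx.1.1.1, (key hx.1.1.2).subst (motive := fun z ↦ z ∈ φ'.source) h2⟩

theorem isLocalDiffeomorph_liftedChartedSpace [IsManifold (𝓡 n) ∞ N] (hf : IsLocalHomeomorph f) :
    letI := liftedChartedSpace (n := n) hf
    IsLocalDiffeomorph (𝓡 n) (𝓡 n) ∞ f := by
  let _ := liftedChartedSpace (n := n) hf
  have := isManifold_liftedChartedSpace (n := n) hf
  intro q
  set φ := chartAt (EuclideanSpace ℝ (Fin n)) (f q) with hφ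
  set c := chartAt (EuclideanSpace ℝ (Fin n)) q with hc
  have hcdef : c = (hf q).choose ≫ₕ φ := rfl
  have hfe := (hf q).choose_spec.2
  have hsource : (c ≫ₕ φ.symm).source ⊆ c.source := fun x hx ↦ hx.1
  refine ⟨⟨(c ≫ₕ φ.symm).toPartialEquiv, (c ≫ₕ φ.symm).open_source, (c ≫ₕ φ.symm).open_target,
    ?_, ?_⟩, ?_, ?_⟩
  · exact (contMDiffOn_chart_symm (x := f q)).comp (contMDiffOn_chart.mono fun x hx ↦ hx.1)
      fun x hx ↦ hx.2
  · exact (contMDiffOn_chart_symm (x := q)).comp (contMDiffOn_chart.mono fun x hx ↦ hx.1)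
      fun x hx ↦ hx.2
  · exact ⟨mem_chart_source _ q, (c.map_source (mem_chart_source _ q)).1⟩
  · intro x hx
    have hx' : (hf q).choose x ∈ φ.source := hx.1.2
    change f x = φ.symm (φ ((hf q).choose x))
    rw [φ.left_inv hx', ← hfe]

end LiftedStructure

/-! ### The orientation covering of the radical -/

section OrientationCover

variable {n : ℕ} {N : Type u} [TopologicalSpace N]
  [ChartedSpace (EuclideanSpace ℝ (Fin n)) N] [IsManifold (𝓡 n) ∞ N]
  {C : Type u} [TopologicalSpace C]
  [ChartedSpace (EuclideanSpace ℝ (Fin n)) C] [IsManifold (𝓡 n) ∞ C]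
  {f : C → N} {q : C} {x : N} {U : Set N} {γ β : TensorField n N}

theorem IsNullOn.pullback (hγ : IsNullOn γ Set.univ) (hf : IsLocalDiffeomorph (𝓡 n) (𝓡 n) ∞ f) :
    IsNullOn (pullbackTensor f γ) Set.univ where
  smooth q _ := ContMDiffAt.contMDiffWithinAt
    ((hγ.smooth.smoothTensorAt (x := f q) univ_mem).pullback (hf q))
  symm q _ v w := hγ.symm (f q) trivial _ _
  finrank_radical q _ := by
    obtain ⟨e, he⟩ := isInvertible_mfderiv (hf q)
    obtain ⟨v, hv, hv0⟩ := exists_radical_ne_zero (hγ.finrank_radical (f q) trivial)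
    have h (w : TangentSpace (𝓡 n) q) (u : TangentSpace (𝓡 n) (f q)) :
        pullbackTensor f γ q w (e.symm u) = γ (f q) (e w) u := by
      change γ (f q) (mfderiv (𝓡 n) (𝓡 n) f q w) (mfderiv (𝓡 n) (𝓡 n) f q (e.symm u)) = _
      rw [← he, ContinuousLinearEquiv.coe_coe, e.apply_symm_apply]
    have hmem : e.symm v ∈ radical (pullbackTensor f γ) q := by
      refine ContinuousLinearMap.ext fun w ↦ ?_
      rw [← e.symm_apply_apply w]
      exact (h _ _).trans (by rw [e.apply_symm_apply, hv]; rfl)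
    refine finrank_eq_one_iff'.2 ⟨⟨e.symm v, hmem⟩, fun h0 ↦ hv0 ?_, fun ⟨w, hw⟩ ↦ ?_⟩
    · exact (map_eq_zero_iff e.symm e.symm.injective).1 (congrArg Subtype.val h0)
    · obtain ⟨c, hc⟩ := exists_smul_of_radical (hγ.finrank_radical (f q) trivial) hv hv0
        (w := e w) (ContinuousLinearMap.ext fun u ↦ by
          rw [← h, show pullbackTensor f γ q w = 0 from hw]; rfl)
      exact ⟨c, Subtype.ext (e.injective (by
        rw [hc]
        change e (c • e.symm v) = _
        rw [map_smul, e.apply_symm_apply]))⟩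

/-- A local diffeomorphism `f` rules its source if a local section of the radical of the target can be
assigned to every point of the source in a locally constant way. -/
theorem isRuledOn_pullback (hγ : IsNullOn γ Set.univ) (hf : IsLocalDiffeomorph (𝓡 n) (𝓡 n) ∞ f)
    (Y : C → VField n N) (hrad : ∀ q, γ (f q) (Y q (f q)) = 0) (hne : ∀ q, Y q (f q) ≠ 0)
    (hY : ∀ q, SmoothFieldAt (Y q) (f q)) (hloc : ∀ q, ∀ᶠ y in 𝓝 q, Y y (f y) = Y q (f y)) :
    IsRuledOn (pullbackTensor f γ) Set.univ := by
  refine ⟨hγ.pullback hf, fun q ↦ mpullback (𝓡 n) (𝓡 n) f (Y q) q, fun q _ ↦ ?_,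
    fun q _ ↦ ⟨ContinuousLinearMap.ext fun w ↦ ?_, fun h ↦ hne q ?_⟩⟩
  · refine (((hY q).mpullback (hf q)).congr_of_eventuallyEq ?_).contMDiffWithinAt
    filter_upwards [hloc q] with y hy
    rw [mpullback_apply, mpullback_apply, hy]
  · change γ (f q) (mfderiv (𝓡 n) (𝓡 n) f q _) _ = 0
    rw [mfderiv_mpullback (hf q), hrad, zero_apply]
  · rw [← mfderiv_mpullback (hf q) (Y q), show mpullback (𝓡 n) (𝓡 n) f (Y q) q = 0 from h, map_zero]

/-- For every point `i` a smooth section of the radical that is defined near `i` and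
normalized by the bilinear form `β`. -/
structure UnitRadicalSections (γ β : TensorField n N) where
  dom : N → Set N
  isOpen_dom : ∀ i, IsOpen (dom i)
  mem_dom : ∀ i, i ∈ dom i
  field : N → VField n N
  smooth : ∀ i, SmoothFieldOn (field i) (dom i)
  radical : ∀ i, ∀ x ∈ dom i, γ x (field i x) = 0
  unit : ∀ i, ∀ x ∈ dom i, β x (field i x) (field i x) = 1

theorem nonempty_unitRadicalSections (hγ : IsNullOn γ Set.univ) (hβ : SmoothTensorOn β Set.univ)
    (hpos : ∀ x v, γ x v = 0 → v ≠ 0 → 0 < β x v v) : Nonempty (UnitRadicalSections γ β) := by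
  have key (i : N) : ∃ (V : Set N) (s : VField n N), IsOpen V ∧ i ∈ V ∧ SmoothFieldOn s V ∧
      (∀ x ∈ V, γ x (s x) = 0) ∧ ∀ x ∈ V, β x (s x) (s x) = 1 := by
    obtain ⟨V, ℓ, hV, hiV, hd⟩ := hγ.exists_local_data i
    obtain ⟨X, hX, hXr⟩ := (hd.isRuledOn hV).exists_section
    have hb (x) (hx : x ∈ V) : 0 < β x (X x) (X x) := hpos x _ (hXr x hx).1 (hXr x hx).2
    refine ⟨V, fun x ↦ (Real.sqrt (β x (X x) (X x)))⁻¹ • X x, hV, hiV, fun x hx ↦ ?_,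
      fun x hx ↦ ?_, fun x hx ↦ ?_⟩
    · have hXs : SmoothFieldAt X x := hX.smoothFieldAt (hV.mem_nhds hx)
      have hsqrt := (Real.contDiffAt_sqrt (n := ∞) (hb x hx).ne').contMDiffAt.comp x
        ((hβ.smoothTensorAt univ_mem).apply₂ hXs hXs)
      exact ((hsqrt.inv₀ (Real.sqrt_pos.2 (hb x hx)).ne').smul_section hXs).contMDiffWithinAt
    · rw [map_smul, show γ x (X x) = 0 from (hXr x hx).1, smul_zero]
    · simp only [map_smul, smul_apply, smul_eq_mul]
      rw [← mul_assoc, ← mul_inv, Real.mul_self_sqrt (hb x hx).le, inv_mul_cancel₀ (hb x hx).ne']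
  choose V s hV hi hs hr hu using key
  exact ⟨⟨V, hV, hi, s, hs, hr, hu⟩⟩

/-- The sign of a non-zero real number as a unit of `ℤ`. -/
def unitSign (c : ℝ) : ℤˣ := if 0 < c then 1 else -1

theorem continuousAt_unitSign {c : ℝ} (hc : c ≠ 0) : ContinuousAt unitSign c := by
  rcases hc.lt_or_gt with h | h
  · refine (continuousAt_const (y := (-1 : ℤˣ))).congr ?_
    filter_upwards [eventually_lt_nhds h] with d hd
    exact (if_neg hd.not_gt).symm
  · refine (continuousAt_const (y := (1 : ℤˣ))).congr ?_
    filter_upwards [eventually_gt_nhds h] with d hd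
    exact (if_pos hd).symm

namespace UnitRadicalSections

variable (S : UnitRadicalSections γ β) {i j k : N}

theorem field_ne_zero (hx : x ∈ S.dom i) : S.field i x ≠ 0 := fun h ↦ by
  have := S.unit i x hx
  rw [h, map_zero] at this
  exact zero_ne_one this

/-- The sign relating the sections with the indices `i` and `j`. -/
def transition (i j x : N) : ℤˣ := unitSign (β x (S.field i x) (S.field j x))

variable {S}

theorem pairing_eq (hγ : IsNullOn γ Set.univ) (hi : x ∈ S.dom i) (hj : x ∈ S.dom j) :
    (β x (S.field i x) (S.field j x) = 1 ∨ β x (S.field i x) (S.field j x) = -1) ∧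
      S.field i x = β x (S.field i x) (S.field j x) • S.field j x := by
  obtain ⟨c, hc⟩ := exists_smul_of_radical (hγ.finrank_radical x trivial) (S.radical j x hj)
    (S.field_ne_zero hj) (S.radical i x hi)
  have h1 := S.unit i x hi
  have h2 := S.unit j x hj
  rw [hc] at h1 ⊢
  simp only [map_smul, smul_apply, smul_eq_mul, h2, mul_one] at h1 ⊢
  exact ⟨mul_self_eq_one_iff.1 h1, trivial⟩

theorem transition_smul (hγ : IsNullOn γ Set.univ) (hi : x ∈ S.dom i) (hj : x ∈ S.dom j) :
    S.field i x = ((S.transition i j x : ℤ) : ℝ) • S.field j x := by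
  obtain ⟨h, h'⟩ := pairing_eq hγ hi hj
  rw [transition, unitSign]
  rcases h with h | h
  · rw [h] at h' ⊢
    simpa using h'
  · rw [h] at h' ⊢
    norm_num
    simpa using h'

theorem eq_of_smul_eq (hi : x ∈ S.dom i) {ε ε' : ℤˣ}
    (h : ((ε : ℤ) : ℝ) • S.field i x = ((ε' : ℤ) : ℝ) • S.field i x) : ε = ε' :=
  Units.ext (Int.cast_injective (smul_left_injective ℝ (S.field_ne_zero hi) h))

variable (S)

/-- The bundle of orientations of the radical. The sheet labelled by `ε` over the domain of the
section with index `i` carries the orientation `ε • S.field i`. -/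
def orientationCore (hγ : IsNullOn γ Set.univ) (hβ : SmoothTensorOn β Set.univ) :
    FiberBundleCore N N ℤˣ where
  baseSet := S.dom
  isOpen_baseSet := S.isOpen_dom
  indexAt := id
  mem_baseSet_at := S.mem_dom
  coordChange i j x ε := S.transition i j x * ε
  coordChange_self i x hx ε := by
    rw [transition, unitSign, S.unit i x hx, if_pos one_pos, one_mul]
  continuousOn_coordChange i j := by
    refine ContinuousOn.mul ?_ continuousOn_snd
    rintro ⟨x, ε⟩ ⟨⟨hi, hj⟩, -⟩
    refine ContinuousAt.continuousWithinAt (ContinuousAt.comp (g := S.transition i j)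
      (f := Prod.fst) ?_ continuousAt_fst)
    have hc : ContinuousAt (fun y ↦ β y (S.field i y) (S.field j y)) x :=
      ((hβ.smoothTensorAt univ_mem).apply₂ ((S.smooth i).smoothFieldAt ((S.isOpen_dom i).mem_nhds hi))
        ((S.smooth j).smoothFieldAt ((S.isOpen_dom j).mem_nhds hj))).continuousAt
    refine ContinuousAt.comp (g := unitSign) (continuousAt_unitSign fun h0 ↦ ?_) hc
    have := (pairing_eq hγ hi hj).2
    rw [h0, zero_smul] at this
    exact S.field_ne_zero hi this
  coordChange_comp := by
    rintro i j k x ⟨⟨hi, hj⟩, hk⟩ ε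
    rw [← mul_assoc]
    congr 1
    refine eq_of_smul_eq hk ?_
    rw [← transition_smul hγ hi hk, transition_smul hγ hi hj, transition_smul hγ hj hk, smul_smul]
    push_cast
    rw [mul_comm]

variable {S} (hγ : IsNullOn γ Set.univ) (hβ : SmoothTensorOn β Set.univ)

theorem t2Space_orientationCover [T2Space N] :
    T2Space (TotalSpace ℤˣ (S.orientationCore hγ hβ).Fiber) := by
  have hcov : IsCoveringMap (TotalSpace.proj (F := ℤˣ) (E := (S.orientationCore hγ hβ).Fiber)) :=
    FiberBundle.isCoveringMap
  refine ⟨fun a b hab ↦ ?_⟩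
  by_cases h : a.proj = b.proj
  · exact hcov.isSeparatedMap a b h hab
  · obtain ⟨u, v, hu, hv, ha, hb, huv⟩ := t2_separation h
    exact ⟨_, _, hu.preimage hcov.continuous, hv.preimage hcov.continuous, ha, hb,
      huv.preimage _⟩

theorem secondCountableTopology_orientationCover [SecondCountableTopology N] :
    SecondCountableTopology (TotalSpace ℤˣ (S.orientationCore hγ hβ).Fiber) := by
  obtain ⟨s, hs, hcover⟩ := TopologicalSpace.countable_cover_nhds
    fun x ↦ (S.isOpen_dom x).mem_nhds (S.mem_dom x)
  have : Countable s := hs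
  have (i : s) : SecondCountableTopology ((S.orientationCore hγ hβ).localTriv i.1).source :=
    ((S.orientationCore hγ hβ).localTriv i.1).sourceHomeomorphBaseSetProd.secondCountableTopology
  refine TopologicalSpace.secondCountableTopology_of_countable_cover
    (fun i : s ↦ ((S.orientationCore hγ hβ).localTriv i.1).open_source) ?_
  refine Set.eq_univ_of_forall fun a ↦ ?_
  have : a.proj ∈ ⋃ x ∈ s, S.dom x := hcover ▸ Set.mem_univ _
  obtain ⟨i, hi, ha⟩ := Set.mem_iUnion₂.1 this
  exact Set.mem_iUnion.2 ⟨⟨i, hi⟩, ((S.orientationCore hγ hβ).mem_localTriv_source i a).2 ha⟩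

/-- The label of the sheet through `q`, relative to the section with the index `q.proj`. -/
def label (q : TotalSpace ℤˣ (S.orientationCore hγ hβ).Fiber) : ℤˣ := q.2

/-- The orientation carried by a sheet is locally constant. -/
theorem eventually_smul_field_eq (q : TotalSpace ℤˣ (S.orientationCore hγ hβ).Fiber) :
    ∀ᶠ y in 𝓝 q, ((label hγ hβ y : ℤ) : ℝ) • S.field y.1 y.1 =
      ((label hγ hβ q : ℤ) : ℝ) • S.field q.1 y.1 := by
  have hsource : q ∈ ((S.orientationCore hγ hβ).localTriv q.1).source :=
    ((S.orientationCore hγ hβ).mem_localTriv_source q.1 q).2 (S.mem_dom q.1)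
  have hcont : ContinuousAt (fun y ↦ ((S.orientationCore hγ hβ).localTriv q.1 y).2) q :=
    continuousAt_snd.comp (((S.orientationCore hγ hβ).localTriv q.1).continuousAt hsource)
  filter_upwards [((S.orientationCore hγ hβ).localTriv q.1).open_source.mem_nhds hsource,
    hcont (mem_nhds_discrete.2 (Set.mem_singleton _))] with y hy hyq
  have hy' : y.1 ∈ S.dom q.1 := ((S.orientationCore hγ hβ).mem_localTriv_source q.1 y).1 hy
  have h1 : S.transition y.1 q.1 y.1 * label hγ hβ y = label hγ hβ q :=
    (Set.mem_singleton_iff.1 hyq).trans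
      ((S.orientationCore hγ hβ).coordChange_self q.1 q.1 (S.mem_dom q.1) q.2)
  rw [← h1, transition_smul hγ (S.mem_dom y.1) hy', smul_smul]
  push_cast
  rw [mul_comm]

theorem isRadicalDoubleCover_orientationCover
    [ChartedSpace (EuclideanSpace ℝ (Fin n)) (TotalSpace ℤˣ (S.orientationCore hγ hβ).Fiber)]
    [IsManifold (𝓡 n) ∞ (TotalSpace ℤˣ (S.orientationCore hγ hβ).Fiber)]
    (hf : IsLocalDiffeomorph (𝓡 n) (𝓡 n) ∞
      (TotalSpace.proj (F := ℤˣ) (E := (S.orientationCore hγ hβ).Fiber))) :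
    IsRadicalDoubleCover γ (TotalSpace.proj (F := ℤˣ) (E := (S.orientationCore hγ hβ).Fiber)) where
  isCoveringMap := FiberBundle.isCoveringMap
  two_sheets p := by
    rw [← TotalSpace.range_mk, ← Set.image_univ,
      Set.ncard_image_of_injective _ (TotalSpace.mk_injective p), Set.ncard_univ]
    change Nat.card ℤˣ = 2
    simp
  isLocalDiffeomorph := hf
  ruled := by
    -- over the sheet of an orientation, the section with this orientation
    refine isRuledOn_pullback hγ hf (fun q ↦ ((label hγ hβ q : ℤ) : ℝ) • S.field q.1)
      (fun q ↦ ?_) (fun q h ↦ ?_) (fun q ↦ ContMDiffAt.const_smul_section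
        ((S.smooth q.1).smoothFieldAt ((S.isOpen_dom q.1).mem_nhds (S.mem_dom q.1)))) (fun q ↦ ?_)
    · rw [Pi.smul_apply, map_smul, S.radical q.1 q.1 (S.mem_dom q.1), smul_zero]
    · have h' : ((label hγ hβ q : ℤ) : ℝ) • S.field q.1 q.1 = 0 := h
      exact S.field_ne_zero (S.mem_dom q.1)
        ((smul_eq_zero.1 h').resolve_left (Int.cast_ne_zero.2 (Units.ne_zero _)))
    · exact eventually_smul_field_eq hγ hβ q

end UnitRadicalSections

/-- The orientation covering of the radical line bundle. -/
theorem IsNullOn.exists_isRadicalDoubleCover [T2Space N] [SecondCountableTopology N]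
    (hγ : IsNullOn γ Set.univ) :
    ∃ (C : Type u) (_ : TopologicalSpace C) (_ : T2Space C) (_ : SecondCountableTopology C)
      (_ : ChartedSpace (EuclideanSpace ℝ (Fin n)) C) (_ : IsManifold (𝓡 n) ∞ C) (f : C → N),
      IsRadicalDoubleCover γ f := by
  obtain ⟨β, hβ, hpos⟩ := hγ.exists_pos_on_radical
  obtain ⟨S⟩ := nonempty_unitRadicalSections hγ hβ hpos
  have hcov : IsCoveringMap (TotalSpace.proj (F := ℤˣ) (E := (S.orientationCore hγ hβ).Fiber)) :=
    FiberBundle.isCoveringMap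
  let _ := liftedChartedSpace (n := n) hcov.isLocalHomeomorph
  have := isManifold_liftedChartedSpace (n := n) hcov.isLocalHomeomorph
  exact ⟨TotalSpace ℤˣ (S.orientationCore hγ hβ).Fiber, inferInstance,
    UnitRadicalSections.t2Space_orientationCover hγ hβ,
    UnitRadicalSections.secondCountableTopology_orientationCover hγ hβ, inferInstance,
    inferInstance, TotalSpace.proj, UnitRadicalSections.isRadicalDoubleCover_orientationCover hγ hβ
      (isLocalDiffeomorph_liftedChartedSpace hcov.isLocalHomeomorph)⟩

end OrientationCover

end NullGeometry

end

theorem theorem3p3 {n : ℕ} {N : Type u} [TopologicalSpace N] [T2Space N]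
    [SecondCountableTopology N] [ChartedSpace (EuclideanSpace ℝ (Fin n)) N]
    [IsManifold (𝓡 n) ∞ N] (γ : NullGeometry.TensorField n N)
    (hγ : NullGeometry.IsNullOn γ Set.univ) :
    -- a double covering trivializing the radical bundle exists
    (∃ (C : Type u) (_ : TopologicalSpace C) (_ : T2Space C) (_ : SecondCountableTopology C)
      (_ : ChartedSpace (EuclideanSpace ℝ (Fin n)) C) (_ : IsManifold (𝓡 n) ∞ C) (f : C → N),
      NullGeometry.IsRadicalDoubleCover γ f) ∧
    -- for every such covering, the family of connections obtained from it
    (∀ (C : Type u) [TopologicalSpace C] [T2Space C] [SecondCountableTopology C]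
      [ChartedSpace (EuclideanSpace ℝ (Fin n)) C] [IsManifold (𝓡 n) ∞ C] (f : C → N),
      NullGeometry.IsRadicalDoubleCover γ f →
      -- compatible data exist, and for all compatible data the metric hypersurface connection
      -- exists and descends to a connection on `N`, unique as an operator on smooth fields
      (∃ (ℓ : NullGeometry.CovectorField n C) (ℓ₂ : C → ℝ),
        NullGeometry.IsCompatibleData γ f ℓ ℓ₂) ∧
      (∀ (ℓ : NullGeometry.CovectorField n C) (ℓ₂ : C → ℝ),
        NullGeometry.IsCompatibleData γ f ℓ ℓ₂ →
        (∃ covC : NullGeometry.Connection n C,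
          NullGeometry.IsMetricHypersurfaceConnectionOn (NullGeometry.pullbackTensor f γ) ℓ ℓ₂
            covC Set.univ) ∧
        ∀ covC : NullGeometry.Connection n C,
          NullGeometry.IsMetricHypersurfaceConnectionOn (NullGeometry.pullbackTensor f γ) ℓ ℓ₂
            covC Set.univ →
          ∃ cov : NullGeometry.Connection n N, NullGeometry.DescendsTo f covC cov ∧
            ∀ cov' : NullGeometry.Connection n N, NullGeometry.DescendsTo f covC cov' →
              ∀ (x : N) (Z : NullGeometry.VField n N), NullGeometry.SmoothFieldAt Z x →
                cov' Z x = cov Z x) ∧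
      -- the family is non-empty
      (NullGeometry.descendedFamily γ f).Nonempty ∧
      -- its members are smooth and torsion-free, and restrict to metric hypersurface connections
      (∀ cov ∈ NullGeometry.descendedFamily γ f,
        CovariantDerivative.ContMDiffCovariantDerivative cov ∞ ∧ cov.torsion = 0 ∧
        ∀ U : Set N, IsOpen U → U.Nonempty → NullGeometry.IsRuledOn γ U →
          ∃ (ℓ : NullGeometry.CovectorField n N) (ℓ₂ : N → ℝ),
            NullGeometry.IsNullDataOn γ ℓ ℓ₂ U ∧
            NullGeometry.IsMetricHypersurfaceConnectionOn γ ℓ ℓ₂ cov U) ∧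
      -- if `(N, γ)` is ruled, the family consists of all its metric hypersurface connections
      (NullGeometry.IsRuledOn γ Set.univ →
        NullGeometry.descendedFamily γ f =
          NullGeometry.metricHypersurfaceFamily γ)) ∧
    -- the gauge element `(z, ζ) = (-1, 0)` preserves the metric hypersurface connection
    (∀ U : Set N, IsOpen U → ∀ (ℓ : NullGeometry.CovectorField n N) (ℓ₂ : N → ℝ),
      NullGeometry.IsNullDataOn γ ℓ ℓ₂ U →
      NullGeometry.IsNullDataOn γ (NullGeometry.gaugeCovector (fun _ ↦ -1) 0 γ ℓ)
        (NullGeometry.gaugeScalar (fun _ ↦ -1) 0 γ ℓ ℓ₂) U ∧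
      ∀ cov : NullGeometry.RawConnection n N,
        NullGeometry.IsMetricHypersurfaceConnectionOn γ ℓ ℓ₂ cov U ↔
        NullGeometry.IsMetricHypersurfaceConnectionOn γ
          (NullGeometry.gaugeCovector (fun _ ↦ -1) 0 γ ℓ)
          (NullGeometry.gaugeScalar (fun _ ↦ -1) 0 γ ℓ ℓ₂) cov U) := by
  refine ⟨hγ.exists_isRadicalDoubleCover, ?_, ?_⟩
  · intro C _ _ _ _ _ f hf
    obtain ⟨ℓ, hℓ⟩ := hf.exists_isCompatibleData hγ
    refine ⟨⟨ℓ, 0, hℓ⟩, fun ℓ ℓ₂ hc ↦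
      ⟨NullGeometry.exists_metricHypersurfaceConnection hc.data, fun covC hcovC ↦ ?_⟩, ?_,
      fun cov hcov ↦ ?_, NullGeometry.descendedFamily_eq_of_isRuledOn hf⟩
    · obtain ⟨cov, hcov⟩ := hc.exists_descendsTo hf hγ hcovC
      exact ⟨cov, hcov, fun cov' hcov' x Z hZ ↦ hcov.eq hcov' hf hZ⟩
    · obtain ⟨covC, hcovC⟩ := NullGeometry.exists_metricHypersurfaceConnection hℓ.data
      obtain ⟨cov, hcov⟩ := hℓ.exists_descendsTo hf hγ hcovC
      exact ⟨cov, ℓ, 0, covC, hℓ, hcovC, hcov⟩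
    · obtain ⟨h₁, h₂⟩ := NullGeometry.contMDiff_and_torsion_eq_zero hf hγ hcov
      exact ⟨h₁, h₂, fun U hU _ hruled ↦
        NullGeometry.exists_data_of_mem_descendedFamily hf hγ hcov hU hruled⟩
  · intro U hU ℓ ℓ₂ hd
    have hcovector : NullGeometry.gaugeCovector (fun _ ↦ -1) 0 γ ℓ = -ℓ := by
      funext x
      ext v
      simp [NullGeometry.gaugeCovector]
    have hscalar : NullGeometry.gaugeScalar (fun _ ↦ -1) 0 γ ℓ ℓ₂ = ℓ₂ := by
      funext x
      simp [NullGeometry.gaugeScalar]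
    rw [hcovector, hscalar]
    exact ⟨hd.neg, fun cov ↦ NullGeometry.isMetricHypersurfaceConnectionOn_neg_iff hU hd⟩
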